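/- **Setting.** An OLSC instance consists of $n$ targets $T_1,\dots,T_n$ in the plane, finitely many obstacles, an angle of view $0<\theta<\pi$, and ranges $0\le R_{\min}\le R_{\max}<\infty$. A target $T_i$ is a nondegenerate segment $\overline{P_i^sP_i^e}$ with midpoint $M_i$ and a nonzero orientation vector $D_i$ perpendicular to it; two different targets may meet only in points that are end points of both. An obstacle is a finite chain of segments. A camera is a pair $(x,\alpha)$ of a location $x\in\mathbb R^2$ and a viewing direction $\alpha$. Its frustum is the set of points $p$ with $R_{\min}\le |p-x|\le R_{\max}$ in the closed wedge with apex $x$, axis at angle $\alpha$ and opening angle $\theta$. A location $x$ has a strict frontal view of $T_i$ if the angle between $D_i$ and $x-M_i$ is $<\pi/2$ and no other target and no obstacle meets the interior of the triangle $xP_i^sP_i^e$. The camera $(x,\alpha)$ *covers* $T_i$ if $T_i$ lies in its frustum and $x$ lies in the closure of the set of locations with a strict frontal view of $T_i$ (so the boundary of the coverage constraints is admitted). For a set $S$ of targets let $A_S$ be the set of locations $x$ such that for some $\alpha$ the camera $(x,\alpha)$ covers all targets of $S$. The Camera Placement Field of $T_i$ is $\mathrm{CPF}_i=A_{\{T_i\}}$.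 Its critical points are its boundary vertices: the points of $\partial\,\mathrm{CPF}_i$ near which $\partial\,\mathrm{CPF}_i$ does not coincide with a single line or circle. The AOV circles are the circles through $p$ and $q$ of radius $|pq|/(2\sin\theta)$ (the chord $pq$ has inscribed angle $\theta$), where $p\ne q$ are end points of two different targets. Intersection points of two curves are the isolated points of their intersection. Let $\mathcal P$ be the set of all critical points of all CPFs, all intersection points of $\partial\,\mathrm{CPF}_i$ and $\partial\,\mathrm{CPF}_j$ $(i\ne j)$, and all intersection points of a $\partial\,\mathrm{CPF}_i$ with an AOV circle. Let $\mathcal R$ be the family of all sets of targets that are, for some $x\in\mathcal P$, maximal among the sets of all targets covered by a camera $(x,\alpha)$, $\alpha\in\mathbb R$. **Theorem.** For every OLSC instance: 1. $\mathcal P$ is finite. 2. For every nonempty set $S$ of targets and every $x\in A_S$ there is a $p\in\mathcal P\cap A_S$ that can be joined to $x$ by a path inside $A_S$. In particular, every nonempty set of targets that a single camera can cover simultaneously is covered by a single camera located at a point of $\mathcal P$. 3. Suppose that some $k$ cameras together cover all targets. Then the greedy set cover algorithm over $\mathcal R$ (repeatedly pick a member of $\mathcal R$ containing the largest number of still uncovered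 targets, ties broken arbitrarily) always reaches a cover of all targets, and every cover it produces has at most $(1+\ln n)\,k$ members; thus it is an $O(\log n)$-approximation of the minimum number of cameras. -/

import Mathlib

open Topology

/-- The Euclidean plane. -/
abbrev Plane : Type := EuclideanSpace ℝ (Fin 2)

/-- The unit vector at angle `α`, measured counter-clockwise from the positive x-axis. -/
noncomputable def viewDir (α : ℝ) : Plane := !₂[Real.cos α, Real.sin α]

/-- An oriented line segment target: a nondegenerate segment with an orientation vector
perpendicular to it. -/
structure OLSTarget where
  start : Plane
  finish : Plane
  orient : Plane
  start_ne_finish : start ≠ finish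
  orient_ne_zero : orient ≠ 0
  orient_perp : inner ℝ orient (finish - start) = 0

namespace OLSTarget

/-- The (closed) line segment of a target. -/
def seg (T : OLSTarget) : Set Plane := segment ℝ T.start T.finish

/-- The two end points of a target. -/
def ends (T : OLSTarget) : Set Plane := {T.start, T.finish}

end OLSTarget

/-- An instance of the oriented line segment coverage problem with `n` targets and `u` obstacles.
An obstacle is a finite chain of segments, each given by its two end points. -/
structure OLSC (n u : ℕ) where
  target : Fin n → OLSTarget
  obstacle : Fin u → List (Plane × Plane)
  /-- angle of view -/
  θ : ℝ
  Rmin : ℝ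
  Rmax : ℝ
  θ_pos : 0 < θ
  θ_lt_pi : θ < Real.pi
  Rmin_nonneg : 0 ≤ Rmin
  Rmin_le_Rmax : Rmin ≤ Rmax
  /-- targets may only intersect at their end points -/
  inter_subset_ends : ∀ i j, i ≠ j →
    (target i).seg ∩ (target j).seg ⊆ (target i).ends ∩ (target j).ends

namespace OLSC

variable {n u : ℕ}

/-- The frustum of a camera at `x` with viewing direction `α`: the points at distance between
`Rmin` and `Rmax` from `x` in the closed wedge with apex `x`, axis at angle `α` and opening
angle `θ`. -/
def frustum (I : OLSC n u) (x : Plane) (α : ℝ) : Set Plane :=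
  {p | I.Rmin ≤ dist x p ∧ dist x p ≤ I.Rmax ∧
    ‖p - x‖ * Real.cos (I.θ / 2) ≤ inner ℝ (viewDir α) (p - x)}

/-- Everything that can occlude target `i`: the other targets and the obstacles. -/
def occluders (I : OLSC n u) (i : Fin n) : Set Plane :=
  {y | (∃ j, j ≠ i ∧ y ∈ (I.target j).seg) ∨
    ∃ k, ∃ σ ∈ I.obstacle k, y ∈ segment ℝ σ.1 σ.2}

/-- From `x` the target `i` is seen from its front, and no sight line from `x` to an inner point
of the target meets an occluder on the way (equivalently, no occluder enters the interior of the
triangle spanned by `x` and the target; merely touching that triangle is not an occlusion). -/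
def StrictFrontalView (I : OLSC n u) (i : Fin n) (x : Plane) : Prop :=
  InnerProductGeometry.angle (I.target i).orient
      (x - midpoint ℝ (I.target i).start (I.target i).finish) < Real.pi / 2 ∧
    ∀ p ∈ openSegment ℝ (I.target i).start (I.target i).finish,
      Disjoint (openSegment ℝ x p) (I.occluders i)

/-- The locations with an unoccluded frontal view of target `i`, boundary included: a rotation of
exactly `π / 2` is admitted where it is a limit of unoccluded frontal views. -/
def frontalView (I : OLSC n u) (i : Fin n) : Set Plane :=
  closure {x | I.StrictFrontalView i x}

/-- A camera at `x` with viewing direction `α` fully covers target `i`. -/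
def Covers (I : OLSC n u) (x : Plane) (α : ℝ) (i : Fin n) : Prop :=
  (I.target i).seg ⊆ I.frustum x α ∧ x ∈ I.frontalView i

/-- The locations from which a single camera, suitably rotated, covers all targets of `S`
simultaneously. -/
def region (I : OLSC n u) (S : Finset (Fin n)) : Set Plane :=
  {x | ∃ α : ℝ, ∀ i ∈ S, I.Covers x α i}

/-- The Camera Placement Field of target `i`. -/
def cpf (I : OLSC n u) (i : Fin n) : Set Plane :=
  {x | ∃ α : ℝ, I.Covers x α i}

/-- The AOV circles of a chord `pq`: the circles through `p` and `q` in which the chord has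
inscribed angle `θ`, that is, those of radius `|pq| / (2 sin θ)`. -/
def aovCirclesOfChord (I : OLSC n u) (p q : Plane) : Set (Set Plane) :=
  {C | ∃ c : Plane, ∃ r : ℝ, r = dist p q / (2 * Real.sin I.θ) ∧
    C = Metric.sphere c r ∧ p ∈ C ∧ q ∈ C}

/-- The AOV circles of all pairs of targets: the chords connect an end point of one target with an
end point of another target. -/
def aovCircles (I : OLSC n u) : Set (Set Plane) :=
  {C | ∃ j k, j ≠ k ∧ ∃ p ∈ (I.target j).ends, ∃ q ∈ (I.target k).ends,
    p ≠ q ∧ C ∈ I.aovCirclesOfChord p q}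

end OLSC

/-- `Γ` is a straight line or a circle in the plane. -/
def IsLineOrCircle (Γ : Set Plane) : Prop :=
  (∃ v : Plane, ∃ b : ℝ, v ≠ 0 ∧ Γ = {x | inner ℝ v x = b}) ∨
    ∃ c : Plane, ∃ r : ℝ, 0 < r ∧ Γ = Metric.sphere c r

/-- The vertices along the boundary of a planar region `A`: the boundary points near which the
boundary is not just one straight or one circular arc passing through the point. -/
def vertices (A : Set Plane) : Set Plane :=
  {z | z ∈ frontier A ∧
    ¬ ∃ Γ, IsLineOrCircle Γ ∧ ∃ V ∈ 𝓝 z, frontier A ∩ V = Γ ∩ V}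

/-- The intersection points of two curves: the isolated points of their intersection. (Where two
curves overlap along an arc, the inner points of that arc are not intersection points.) -/
def crossings (A B : Set Plane) : Set Plane :=
  {z | ∃ V ∈ 𝓝 z, (A ∩ B) ∩ V = {z}}

namespace OLSC

variable {n u : ℕ}

/-- The candidate locations: the critical points of all CPFs, the pairwise intersection points of
CPF boundaries, and the intersection points of CPF boundaries with AOV circles. -/
def candidates (I : OLSC n u) : Set Plane :=
  (⋃ i, vertices (I.cpf i)) ∪
  {z | ∃ i j, i ≠ j ∧ z ∈ crossings (frontier (I.cpf i)) (frontier (I.cpf j))} ∪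
  {z | ∃ i, ∃ C ∈ I.aovCircles, z ∈ crossings (frontier (I.cpf i)) C}

open Classical in
/-- The set of targets covered by a camera at `x` with viewing direction `α`. -/
noncomputable def cov (I : OLSC n u) (x : Plane) (α : ℝ) : Finset (Fin n) :=
  Finset.univ.filter fun i => I.Covers x α i

/-- The configurations offered to set cover: for each candidate location, the maximal sets of
targets that a camera placed there can cover simultaneously. -/
def configurations (I : OLSC n u) : Set (Finset (Fin n)) :=
  {C | ∃ x ∈ I.candidates, Maximal (fun D => ∃ α : ℝ, D = I.cov x α) C}

end OLSC

/-- `GreedyRun R U l`: starting with the set `U` of uncovered elements, the greedy set cover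
algorithm over the family `R`, with some way of breaking ties, picks the sets in the list `l`, in
this order, and stops with everything covered. -/
inductive GreedyRun {ι : Type} [DecidableEq ι] (R : Set (Finset ι)) :
    Finset ι → List (Finset ι) → Prop
  | done : GreedyRun R ∅ []
  | pick (U C : Finset ι) (l : List (Finset ι)) (hU : U.Nonempty) (hC : C ∈ R)
      (hmax : ∀ D ∈ R, (D ∩ U).card ≤ (C ∩ U).card) (hl : GreedyRun R (U \ C) l) :
      GreedyRun R U (C :: l)

/-! Membership of a point in a Camera Placement Field is decided by the signs, at that point, of
finitely many equations of lines and circles: the lines bounding the shadows of the occluding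
segments, the lines and circles of the range constraint, and the circles on which a target is seen
at angle `θ`. Away from finitely many points the frontier of the field is therefore empty or locally
a single line or circle, and two different lines or circles meet in at most two points. Hence there
are only finitely many candidates.

A camera covering `S` is first moved straight backwards until it meets the frontier of some field,
and then along that frontier. The covered targets can change only where another curve is crossed,
which happens at candidates. As the fields are bounded, a motion that never meets a candidate would
run around a full circle contained in the frontier, but every such circle reaches behind the target.
The angle constraints between targets degenerate at their end points, but these are vertices of the
field of their target, hence candidates, as soon as they belong to it.

For the greedy bound, if `k` sets of the family cover the `u` remaining elements, then a greedy pick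
leaves at most `(1 - 1/k) u` of them, so that `log u` drops by at least `1/k` in each step but the
last. -/

/-! ### Sets cut out by signs of functions -/

section SignConditions

variable {X : Type*} [TopologicalSpace X]

/-- Membership in `A` is determined by the signs of the functions in `F`. -/
def SignDetermined {X : Type*} (F : Set (X → ℝ)) (A : Set X) : Prop :=
  ∀ x y, (∀ f ∈ F, SignType.sign (f x) = SignType.sign (f y)) → x ∈ A → y ∈ A

/-- Near `z`, membership in `A` is determined by the sign of the single function `g`. -/
def SignDeterminedAt (g : X → ℝ) (A : Set X) (z : X) : Prop :=
  ∃ s : Set SignType, ∀ᶠ x in 𝓝 z, (x ∈ A ↔ SignType.sign (g x) ∈ s)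

/-- A continuous function that takes positive and negative values arbitrarily close to each of its
zeros. -/
structure ChangesSignAtZeros (g : X → ℝ) : Prop where
  continuous : Continuous g
  frequently_pos : ∀ z, g z = 0 → ∃ᶠ x in 𝓝 z, 0 < g x
  frequently_neg : ∀ z, g z = 0 → ∃ᶠ x in 𝓝 z, g x < 0

theorem SignDetermined.mono {X : Type*} {F G : Set (X → ℝ)} {A : Set X} (h : SignDetermined F A)
    (hFG : F ⊆ G) : SignDetermined G A :=
  fun x y hs => h x y fun f hf => hs f (hFG hf)

theorem eventually_sign_eq {g : X → ℝ} {x : X} (hg : ContinuousAt g x) (hx : g x ≠ 0) :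
    ∀ᶠ y in 𝓝 x, SignType.sign (g y) = SignType.sign (g x) := by
  rcases hx.lt_or_gt with h | h
  · filter_upwards [hg.eventually_lt_const h] with y hy
    rw [sign_neg hy, sign_neg h]
  · filter_upwards [hg.eventually_const_lt h] with y hy
    rw [sign_pos hy, sign_pos h]

theorem SignDeterminedAt.inter {g : X → ℝ} {A B : Set X} {z : X} (hA : SignDeterminedAt g A z)
    (hB : SignDeterminedAt g B z) : SignDeterminedAt g (A ∩ B) z := by
  obtain ⟨s, hs⟩ := hA
  obtain ⟨t, ht⟩ := hB
  exact ⟨s ∩ t, by filter_upwards [hs, ht] with x hx hx' using and_congr hx hx'⟩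

theorem ChangesSignAtZeros.eventually_mem_closure_iff {g : X → ℝ} (hg : ChangesSignAtZeros g)
    {A : Set X} {z : X} {s : Set SignType}
    (hA : ∀ᶠ x in 𝓝 z, (x ∈ A ↔ SignType.sign (g x) ∈ s)) :
    ∀ᶠ x in 𝓝 z, (x ∈ closure A ↔ SignType.sign (g x) ∈ s ∨ g x = 0 ∧ s.Nonempty) := by
  filter_upwards [hA.eventually_nhds] with x hx
  rw [mem_closure_iff_frequently]
  constructor
  · intro hfreq
    by_cases hgx : g x = 0
    · obtain ⟨y, hyA, hy⟩ := (hfreq.and_eventually hx).exists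
      exact Or.inr ⟨hgx, _, hy.1 hyA⟩
    · obtain ⟨y, hyA, hy, hsign⟩ := (hfreq.and_eventually
        (hx.and (eventually_sign_eq hg.continuous.continuousAt hgx))).exists
      exact Or.inl (hsign ▸ hy.1 hyA)
  · rintro (hmem | ⟨hgx, σ, hσ⟩)
    · exact mem_closure_iff_frequently.1 (subset_closure (hx.self_of_nhds.2 hmem))
    · rcases σ.trichotomy with rfl | rfl | rfl
      · exact ((hg.frequently_neg x hgx).and_eventually hx).mono fun y ⟨hy, h⟩ =>
          h.2 ((sign_neg hy).symm ▸ hσ)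
      · refine mem_closure_iff_frequently.1 (subset_closure (hx.self_of_nhds.2 ?_))
        rwa [hgx, sign_zero]
      · exact ((hg.frequently_pos x hgx).and_eventually hx).mono fun y ⟨hy, h⟩ =>
          h.2 ((sign_pos hy).symm ▸ hσ)

theorem SignDeterminedAt.closure {g : X → ℝ} {A : Set X} {z : X} (hA : SignDeterminedAt g A z)
    (hg : ChangesSignAtZeros g) : SignDeterminedAt g (closure A) z := by
  obtain ⟨s, hs⟩ := hA
  refine ⟨{σ | σ ∈ s ∨ σ = 0 ∧ s.Nonempty}, ?_⟩
  filter_upwards [hg.eventually_mem_closure_iff hs] with x hx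
  rw [hx, ← sign_eq_zero_iff (a := g x)]

theorem SignDeterminedAt.eventually_mem_frontier_iff {g : X → ℝ} {A : Set X} {z : X}
    (hA : SignDeterminedAt g A z) (hg : ChangesSignAtZeros g) (hz : z ∈ frontier A) :
    ∀ᶠ x in 𝓝 z, (x ∈ frontier A ↔ g x = 0) := by
  obtain ⟨s, hs⟩ := hA
  have hs' : ∀ᶠ x in 𝓝 z, (x ∈ Aᶜ ↔ SignType.sign (g x) ∈ sᶜ) := hs.mono fun x => not_congr
  have hfrontier : ∀ᶠ x in 𝓝 z, (x ∈ frontier A ↔ g x = 0 ∧ s.Nonempty ∧ sᶜ.Nonempty) := by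
    filter_upwards [hg.eventually_mem_closure_iff hs, hg.eventually_mem_closure_iff hs']
      with x hx hx'
    rw [frontier_eq_closure_inter_closure, Set.mem_inter_iff, hx, hx', Set.mem_compl_iff]
    constructor
    · rintro ⟨h | h, h' | h'⟩
      · exact absurd h h'
      · exact ⟨h'.1, ⟨_, h⟩, h'.2⟩
      · exact ⟨h.1, h.2, ⟨_, h'⟩⟩
      · exact ⟨h.1, h.2, h'.2⟩
    · exact fun h => ⟨Or.inr ⟨h.1, h.2.1⟩, Or.inr ⟨h.1, h.2.2⟩⟩
  obtain ⟨-, hne⟩ := hfrontier.self_of_nhds.1 hz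
  filter_upwards [hfrontier] with x hx
  rw [hx, and_iff_left hne]

end SignConditions

section SignComparison

variable {a b : ℝ}

theorem pos_iff_of_sign_eq (h : SignType.sign a = SignType.sign b) : 0 < a ↔ 0 < b := by
  rw [← sign_eq_one_iff, h, sign_eq_one_iff]

theorem neg_iff_of_sign_eq (h : SignType.sign a = SignType.sign b) : a < 0 ↔ b < 0 := by
  rw [← sign_eq_neg_one_iff, h, sign_eq_neg_one_iff]

theorem nonneg_iff_of_sign_eq (h : SignType.sign a = SignType.sign b) : 0 ≤ a ↔ 0 ≤ b := by
  simpa only [not_lt] using not_congr (neg_iff_of_sign_eq h)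

theorem nonpos_iff_of_sign_eq (h : SignType.sign a = SignType.sign b) : a ≤ 0 ↔ b ≤ 0 := by
  simpa only [not_lt] using not_congr (pos_iff_of_sign_eq h)

end SignComparison

/-! ### Hyperplanes and spheres -/

section IsotropicQuadratic

variable {E : Type*} [NormedAddCommGroup E] [InnerProductSpace ℝ E]

/-- Quadratic functions `a ‖x‖² + ⟪v, x⟫ + d`, whose leading form is a multiple of the norm
squared. -/
def IsIsotropicQuadratic (f : E → ℝ) : Prop :=
  ∃ (a : ℝ) (v : E) (d : ℝ), ∀ x, f x = a * ‖x‖ ^ 2 + inner ℝ v x + d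

/-- Isotropic quadratic functions with positive discriminant: the equations of hyperplanes and of
spheres of positive radius, up to nonzero factors. -/
def IsHyperplaneOrSphereEq (g : E → ℝ) : Prop :=
  ∃ (a : ℝ) (v : E) (d : ℝ), 0 < ‖v‖ ^ 2 - 4 * a * d ∧
    ∀ x, g x = a * ‖x‖ ^ 2 + inner ℝ v x + d

namespace IsIsotropicQuadratic

variable {f g : E → ℝ}

theorem continuous (hf : IsIsotropicQuadratic f) : Continuous f := by
  obtain ⟨a, v, d, h⟩ := hf
  rw [funext h]
  fun_prop

theorem const_mul (l : ℝ) (hf : IsIsotropicQuadratic f) :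
    IsIsotropicQuadratic fun x => l * f x := by
  obtain ⟨a, v, d, h⟩ := hf
  exact ⟨l * a, l • v, l * d, fun x => by simp only [h, real_inner_smul_left]; ring⟩

end IsIsotropicQuadratic

theorem isIsotropicQuadratic_inner_add (v : E) (d : ℝ) :
    IsIsotropicQuadratic fun x => inner ℝ v x + d :=
  ⟨0, v, d, fun x => by ring⟩

theorem isIsotropicQuadratic_dist_sq_sub (c : E) (d : ℝ) :
    IsIsotropicQuadratic fun x => dist x c ^ 2 - d :=
  ⟨1, (-2 : ℝ) • c, ‖c‖ ^ 2 - d, fun x => by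
    simp only [dist_eq_norm, norm_sub_sq_real, real_inner_smul_left, real_inner_comm c x]; ring⟩

theorem completing_the_square {a : ℝ} (ha : a ≠ 0) (v x : E) (d : ℝ) :
    a * ‖x‖ ^ 2 + inner ℝ v x + d =
      a * (dist x (-(2 * a)⁻¹ • v) ^ 2 - (‖v‖ ^ 2 - 4 * a * d) / (2 * a) ^ 2) := by
  rw [dist_eq_norm, norm_sub_sq_real, norm_smul, real_inner_smul_right, real_inner_comm, mul_pow,
    Real.norm_eq_abs, sq_abs]
  field_simp
  ring

theorem IsIsotropicQuadratic.eq_zero_or_subsingleton_or_isHyperplaneOrSphereEq {f : E → ℝ}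
    (hf : IsIsotropicQuadratic f) :
    f = 0 ∨ {x | f x = 0}.Subsingleton ∨ IsHyperplaneOrSphereEq f := by
  obtain ⟨a, v, d, h⟩ := hf
  rcases lt_or_ge 0 (‖v‖ ^ 2 - 4 * a * d) with hpos | hle
  · exact Or.inr (Or.inr ⟨a, v, d, hpos, h⟩)
  by_cases ha : a = 0
  · subst ha
    have hv : v = 0 := by
      rw [← norm_eq_zero, ← sq_nonpos_iff]
      linarith
    have hconst : ∀ x, f x = d := fun x => by simp [h, hv]
    by_cases hd : d = 0
    · exact Or.inl (funext fun x => (hconst x).trans hd)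
    · exact Or.inr (Or.inl fun x hx => absurd ((hconst x).symm.trans hx) hd)
  · have hcenter : ∀ x, f x = 0 → x = -(2 * a)⁻¹ • v := by
      intro x hx
      rw [h, completing_the_square ha, mul_eq_zero_iff_left ha, sub_eq_zero] at hx
      rw [← dist_eq_zero, ← sq_nonpos_iff, hx]
      exact div_nonpos_of_nonpos_of_nonneg hle (sq_nonneg _)
    exact Or.inr (Or.inl fun x hx y hy => (hcenter x hx).trans (hcenter y hy).symm)

theorem inner_inversion_eq_neg {a : ℝ} {w y : E} (hy : y ≠ 0)
    (h : a * ‖y‖ ^ 2 + inner ℝ w y = 0) :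
    inner ℝ w (EuclideanGeometry.inversion 0 1 y) = -a := by
  rw [EuclideanGeometry.inversion_def]
  simp only [dist_zero_right, vsub_eq_sub, vadd_eq_add, sub_zero, add_zero, real_inner_smul_right]
  field_simp
  linear_combination h

theorem isHyperplaneOrSphereEq_inner_add {v : E} (hv : v ≠ 0) (d : ℝ) :
    IsHyperplaneOrSphereEq fun x => inner ℝ v x + d :=
  ⟨0, v, d, by simpa [sq_pos_iff] using hv, fun x => by ring⟩

theorem isHyperplaneOrSphereEq_dist_sq_sub (c : E) {r : ℝ} (hr : 0 < r) :
    IsHyperplaneOrSphereEq fun x => dist x c ^ 2 - r ^ 2 := by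
  refine ⟨1, (-2 : ℝ) • c, ‖c‖ ^ 2 - r ^ 2, ?_, fun x => ?_⟩
  · rw [norm_smul, mul_pow, Real.norm_eq_abs, sq_abs]
    linarith [pow_pos hr 2]
  · simp only [dist_eq_norm, norm_sub_sq_real, real_inner_smul_left, real_inner_comm c x]
    ring

namespace IsHyperplaneOrSphereEq

variable {g : E → ℝ}

theorem isIsotropicQuadratic (hg : IsHyperplaneOrSphereEq g) : IsIsotropicQuadratic g := by
  obtain ⟨a, v, d, -, h⟩ := hg
  exact ⟨a, v, d, h⟩

theorem const_mul (hg : IsHyperplaneOrSphereEq g) {l : ℝ} (hl : l ≠ 0) :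
    IsHyperplaneOrSphereEq fun x => l * g x := by
  obtain ⟨a, v, d, hpos, h⟩ := hg
  refine ⟨l * a, l • v, l * d, ?_, fun x => ?_⟩
  · rw [norm_smul, mul_pow, Real.norm_eq_abs, sq_abs]
    calc 0 < l ^ 2 * (‖v‖ ^ 2 - 4 * a * d) := by positivity
      _ = l ^ 2 * ‖v‖ ^ 2 - 4 * (l * a) * (l * d) := by ring
  · simp only [h, real_inner_smul_left]
    ring

theorem hyperplane_or_sphere (hg : IsHyperplaneOrSphereEq g) :
    (∃ (v : E) (d : ℝ), v ≠ 0 ∧ ∀ x, g x = inner ℝ v x + d) ∨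
      ∃ (a : ℝ) (c : E) (r : ℝ), a ≠ 0 ∧ 0 < r ∧ ∀ x, g x = a * (dist x c ^ 2 - r ^ 2) := by
  obtain ⟨a, v, d, hpos, h⟩ := hg
  by_cases ha : a = 0
  · subst ha
    refine Or.inl ⟨v, d, ?_, fun x => by rw [h]; ring⟩
    rintro rfl
    simp at hpos
  · refine Or.inr ⟨a, -(2 * a)⁻¹ • v, √((‖v‖ ^ 2 - 4 * a * d) / (2 * a) ^ 2), ha,
      Real.sqrt_pos.2 (by positivity), fun x => ?_⟩
    rw [h, completing_the_square ha, Real.sq_sqrt (by positivity)]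

theorem exists_expansion (hg : IsHyperplaneOrSphereEq g) {z : E} (hz : g z = 0) :
    ∃ (a : ℝ) (w : E), w ≠ 0 ∧ ∀ y, g (z + y) = a * ‖y‖ ^ 2 + inner ℝ w y := by
  obtain ⟨a, v, d, hpos, h⟩ := hg
  rw [h] at hz
  refine ⟨a, (2 * a) • z + v, ?_, fun y => ?_⟩
  · suffices ‖(2 * a) • z + v‖ ^ 2 = ‖v‖ ^ 2 - 4 * a * d by
      rw [← norm_ne_zero_iff, ← sq_pos_iff, this]
      exact hpos
    rw [norm_add_sq_real, norm_smul, mul_pow, Real.norm_eq_abs, sq_abs, real_inner_smul_left,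
      real_inner_comm]
    linear_combination 4 * a * hz
  · rw [h, norm_add_sq_real, inner_add_right, inner_add_left, real_inner_smul_left]
    linear_combination hz

theorem frequently_pos (hg : IsHyperplaneOrSphereEq g) {z : E} (hz : g z = 0) :
    ∃ᶠ x in 𝓝 z, 0 < g x := by
  obtain ⟨a, w, hw, h⟩ := hg.exists_expansion hz
  have hval : ∀ t : ℝ, g (z + t • w) = t * ‖w‖ ^ 2 * (1 + a * t) := by
    intro t
    rw [h, norm_smul, real_inner_smul_right, real_inner_self_eq_norm_sq, mul_pow,
      Real.norm_eq_abs, sq_abs]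
    ring
  have htendsto : Filter.Tendsto (fun t : ℝ => z + t • w) (𝓝[>] 0) (𝓝 z) := by
    have hcont : Continuous fun t : ℝ => z + t • w := by fun_prop
    simpa using (hcont.tendsto 0).mono_left nhdsWithin_le_nhds
  have hfactor : ∀ᶠ t : ℝ in 𝓝[>] 0, 0 < 1 + a * t := by
    have hcont : Continuous fun t : ℝ => 1 + a * t := by fun_prop
    exact nhdsWithin_le_nhds (hcont.continuousAt.eventually_const_lt (by simp))
  refine htendsto.frequently (Filter.Eventually.frequently ?_)
  filter_upwards [hfactor, self_mem_nhdsWithin] with t ht ht0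
  rw [hval]
  exact mul_pos (mul_pos ht0 (pow_pos (norm_pos_iff.2 hw) 2)) ht

theorem changesSignAtZeros (hg : IsHyperplaneOrSphereEq g) : ChangesSignAtZeros g where
  continuous := hg.isIsotropicQuadratic.continuous
  frequently_pos _ := hg.frequently_pos
  frequently_neg z hz := by
    have hneg := (hg.const_mul (neg_ne_zero.2 one_ne_zero)).frequently_pos (z := z) (by simp [hz])
    simpa using hneg

end IsHyperplaneOrSphereEq

end IsotropicQuadratic

/-! ### Lines and circles in the plane -/

namespace Plane

/-- Counter-clockwise rotation by a right angle. -/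
noncomputable def rot (v : Plane) : Plane := !₂[-v 1, v 0]

/-- The signed area of the parallelogram spanned by `u` and `v`. -/
def cross (u v : Plane) : ℝ := u 0 * v 1 - u 1 * v 0

variable (u v w : Plane)

@[simp] theorem rot_zero : rot v 0 = -v 1 := rfl

@[simp] theorem rot_one : rot v 1 = v 0 := rfl

theorem inner_eq : inner ℝ u v = u 0 * v 0 + u 1 * v 1 := by
  simp [PiLp.inner_apply, Fin.sum_univ_two, mul_comm]

theorem norm_sq_eq : ‖v‖ ^ 2 = v 0 ^ 2 + v 1 ^ 2 := by
  simp [EuclideanSpace.norm_sq_eq, Fin.sum_univ_two]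

theorem dist_sq_eq : dist u v ^ 2 = (u 0 - v 0) ^ 2 + (u 1 - v 1) ^ 2 := by
  rw [dist_eq_norm, norm_sq_eq, PiLp.sub_apply, PiLp.sub_apply]

theorem ext {u v : Plane} (h0 : u 0 = v 0) (h1 : u 1 = v 1) : u = v := by
  ext i
  fin_cases i
  · exact h0
  · exact h1

theorem inner_rot : inner ℝ (rot u) v = cross u v := by
  rw [inner_eq, rot_zero, rot_one, cross]
  ring

theorem inner_rot_self : inner ℝ v (rot v) = 0 := by
  rw [inner_eq, rot_zero, rot_one]
  ring

theorem norm_rot : ‖rot v‖ = ‖v‖ := by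
  rw [← sq_eq_sq₀ (norm_nonneg _) (norm_nonneg _), norm_sq_eq, norm_sq_eq, rot_zero, rot_one]
  ring

theorem rot_neg : rot (-v) = -rot v :=
  ext rfl rfl

theorem cross_swap : cross u v = -cross v u := by
  rw [cross, cross]
  ring

theorem inner_sq_add_cross_sq : inner ℝ u v ^ 2 + cross u v ^ 2 = (‖u‖ * ‖v‖) ^ 2 := by
  rw [mul_pow, norm_sq_eq, norm_sq_eq, inner_eq, cross]
  ring

theorem norm_sq_smul_eq : ‖u‖ ^ 2 • v = (inner ℝ u v : ℝ) • u + cross u v • rot u := by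
  refine Plane.ext ?_ ?_ <;>
  · simp only [norm_sq_eq, inner_eq, cross, PiLp.add_apply, PiLp.smul_apply, smul_eq_mul,
      rot_zero, rot_one]
    ring

variable {u v w}

theorem exists_smul_eq_of_cross_eq_zero (hu : u ≠ 0) (h : cross u v = 0) : ∃ l : ℝ, v = l • u := by
  have hnorm : ‖u‖ ^ 2 ≠ 0 := pow_ne_zero 2 (norm_ne_zero_iff.2 hu)
  refine ⟨(‖u‖ ^ 2)⁻¹ * inner ℝ u v, ?_⟩
  rw [mul_smul, eq_inv_smul_iff₀ hnorm, norm_sq_smul_eq, h, zero_smul, add_zero]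

theorem exists_eq_smul_rot_of_inner_eq_zero (hu : u ≠ 0) (h : inner ℝ u v = 0) :
    ∃ l : ℝ, v = l • rot u := by
  have hnorm : ‖u‖ ^ 2 ≠ 0 := pow_ne_zero 2 (norm_ne_zero_iff.2 hu)
  refine ⟨(‖u‖ ^ 2)⁻¹ * cross u v, ?_⟩
  rw [mul_smul, eq_inv_smul_iff₀ hnorm, norm_sq_smul_eq, h, zero_smul, zero_add]

theorem eq_of_inner_eq_of_cross_ne_zero {x y : Plane} (h : cross u v ≠ 0)
    (hu : inner ℝ u x = inner ℝ u y) (hv : inner ℝ v x = inner ℝ v y) : x = y := by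
  rw [inner_eq, inner_eq] at hu hv
  refine Plane.ext (mul_left_cancel₀ h ?_) (mul_left_cancel₀ h ?_) <;> rw [cross]
  · linear_combination v 1 * hu - u 1 * hv
  · linear_combination u 0 * hv - v 0 * hu

end Plane

theorem isLineOrCircle_iff {Γ : Set Plane} :
    IsLineOrCircle Γ ↔ ∃ g, IsHyperplaneOrSphereEq g ∧ Γ = {x | g x = 0} := by
  constructor
  · rintro (⟨v, b, hv, rfl⟩ | ⟨c, r, hr, rfl⟩)
    · refine ⟨fun x => inner ℝ v x + -b, isHyperplaneOrSphereEq_inner_add hv _, ?_⟩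
      ext x
      exact add_neg_eq_zero.symm
    · refine ⟨fun x => dist x c ^ 2 - r ^ 2, isHyperplaneOrSphereEq_dist_sq_sub c hr, ?_⟩
      ext x
      rw [Metric.mem_sphere, Set.mem_ofPred_eq, sub_eq_zero, sq_eq_sq₀ dist_nonneg hr.le]
  · rintro ⟨g, hg, rfl⟩
    rcases hg.hyperplane_or_sphere with ⟨v, d, hv, h⟩ | ⟨a, c, r, ha, hr, h⟩
    · refine Or.inl ⟨v, -d, hv, ?_⟩
      ext x
      rw [Set.mem_ofPred_eq, h, Set.mem_ofPred_eq, add_eq_zero_iff_eq_neg]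
    · refine Or.inr ⟨c, r, hr, ?_⟩
      ext x
      rw [Metric.mem_sphere, Set.mem_ofPred_eq, h, mul_eq_zero_iff_left ha, sub_eq_zero,
        sq_eq_sq₀ dist_nonneg hr.le]

theorem IsHyperplaneOrSphereEq.finite_setOf_zero_or_smul {g g' : Plane → ℝ}
    (hg : IsHyperplaneOrSphereEq g) (hg' : IsHyperplaneOrSphereEq g') :
    {x | g x = 0 ∧ g' x = 0}.Finite ∨ ∃ l : ℝ, l ≠ 0 ∧ g' = l • g := by
  rcases {x | g x = 0 ∧ g' x = 0}.eq_empty_or_nonempty with hempty | ⟨z, hz, hz'⟩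
  · exact Or.inl (hempty ▸ Set.finite_empty)
  obtain ⟨a, w, hw, h⟩ := hg.exists_expansion hz
  obtain ⟨a', w', hw', h'⟩ := hg'.exists_expansion hz'
  suffices key : {y | g (z + y) = 0 ∧ g' (z + y) = 0}.Finite ∨ ∃ l : ℝ, w' = l • w ∧ a' = l * a by
    refine key.imp (fun hfin => ?_) ?_
    · exact (hfin.image (z + ·)).subset fun x hx => ⟨x - z, by simpa using hx, by simp⟩
    · rintro ⟨l, rfl, rfl⟩
      refine ⟨l, left_ne_zero_of_smul hw', funext fun x => ?_⟩
      rw [← add_sub_cancel z x, h', Pi.smul_apply, h, real_inner_smul_left, smul_eq_mul]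
      ring
  simp only [h, h']
  by_cases hcross : Plane.cross w w' = 0
  · obtain ⟨l, rfl⟩ := Plane.exists_smul_eq_of_cross_eq_zero hw hcross
    by_cases ha : a' = l * a
    · exact Or.inr ⟨l, rfl, ha⟩
    · refine Or.inl ((Set.finite_singleton 0).subset fun y ⟨hy, hy'⟩ => ?_)
      rw [real_inner_smul_left] at hy'
      have hprod : (a' - l * a) * ‖y‖ ^ 2 = 0 := by linear_combination hy' - l * hy
      simpa [sub_ne_zero.2 ha] using hprod
  · -- Inversion turns the two curves into lines with different directions.
    have huniq : {y | y ≠ 0 ∧ a * ‖y‖ ^ 2 + inner ℝ w y = 0 ∧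
        a' * ‖y‖ ^ 2 + inner ℝ w' y = 0}.Subsingleton := by
      rintro x ⟨hx0, hx, hx'⟩ y ⟨hy0, hy, hy'⟩
      refine EuclideanGeometry.inversion_injective (0 : Plane) one_ne_zero
        (Plane.eq_of_inner_eq_of_cross_ne_zero hcross ?_ ?_)
      · rw [inner_inversion_eq_neg hx0 hx, inner_inversion_eq_neg hy0 hy]
      · rw [inner_inversion_eq_neg hx0 hx', inner_inversion_eq_neg hy0 hy']
    refine Or.inl ((huniq.finite.insert 0).subset fun y hy => ?_)
    exact (eq_or_ne y 0).imp_right fun hy0 => ⟨hy0, hy⟩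

theorem hasDerivAt_viewDir (t : ℝ) : HasDerivAt viewDir (Plane.rot (viewDir t)) t := by
  have hcoord : HasDerivAt (fun s => ![Real.cos s, Real.sin s]) ![-Real.sin t, Real.cos t] t := by
    refine hasDerivAt_pi.2 fun i => ?_
    fin_cases i
    · exact Real.hasDerivAt_cos t
    · exact Real.hasDerivAt_sin t
  exact (PiLp.continuousLinearEquiv 2 ℝ _).symm.hasFDerivAt.comp_hasDerivAt t hcoord

theorem norm_viewDir (α : ℝ) : ‖viewDir α‖ = 1 := by
  rw [← sq_eq_sq₀ (norm_nonneg _) zero_le_one, Plane.norm_sq_eq, one_pow]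
  exact Real.cos_sq_add_sin_sq α

theorem viewDir_add_nat_mul_two_pi (α : ℝ) (N : ℕ) :
    viewDir (α + N * (2 * Real.pi)) = viewDir α :=
  Plane.ext (Real.cos_add_nat_mul_two_pi α N) (Real.sin_add_nat_mul_two_pi α N)

theorem Plane.exists_eq_norm_smul_viewDir (v : Plane) : ∃ φ, v = ‖v‖ • viewDir φ := by
  let w : ℂ := ⟨v 0, v 1⟩
  have hw : ‖w‖ = ‖v‖ := by
    rw [← sq_eq_sq₀ (norm_nonneg _) (norm_nonneg _), Complex.sq_norm, Complex.normSq_apply,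
      Plane.norm_sq_eq, sq, sq]
  refine ⟨w.arg, Plane.ext ?_ ?_⟩
  · exact (hw ▸ Complex.norm_mul_cos_arg w).symm
  · exact (hw ▸ Complex.norm_mul_sin_arg w).symm

theorem exists_param_line {v : Plane} (hv : v ≠ 0) {d : ℝ} {z : Plane}
    (hz : inner ℝ v z + d = 0) :
    ∃ γ γ' : ℝ → Plane, γ 0 = z ∧ (∀ t, inner ℝ v (γ t) + d = 0) ∧
      (∀ t, HasDerivAt γ (γ' t) t ∧ γ' t ≠ 0) ∧ ∀ M : ℝ, ∃ t ≥ 0, M < ‖γ t‖ := by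
  have hpos : 0 < ‖Plane.rot v‖ := by rwa [Plane.norm_rot, norm_pos_iff]
  refine ⟨fun t => z + t • Plane.rot v, fun _ => Plane.rot v, by simp, fun t => ?_,
    fun t => ⟨?_, norm_pos_iff.1 hpos⟩, fun M => ?_⟩
  · rw [inner_add_right, real_inner_smul_right, Plane.inner_rot_self, mul_zero, add_zero, hz]
  · simpa using ((hasDerivAt_id t).smul_const (Plane.rot v)).const_add z
  · refine ⟨(|M| + 1 + ‖z‖) / ‖Plane.rot v‖, by positivity, ?_⟩
    have htriangle := norm_sub_le (z + ((|M| + 1 + ‖z‖) / ‖Plane.rot v‖) • Plane.rot v) z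
    rw [add_sub_cancel_left, norm_smul, Real.norm_of_nonneg (by positivity),
      div_mul_cancel₀ _ hpos.ne'] at htriangle
    linarith [le_abs_self M]

theorem exists_param_circle {c : Plane} {r : ℝ} (hr : 0 < r) {z : Plane} (hz : dist z c = r) :
    ∃ γ γ' : ℝ → Plane, γ 0 = z ∧ (∀ t, dist (γ t) c = r) ∧
      (∀ t, HasDerivAt γ (γ' t) t ∧ γ' t ≠ 0) ∧ ∀ x, dist x c = r → ∃ t ≥ 0, γ t = x := by
  have hpolar : ∀ x, dist x c = r → ∃ φ, x = c + r • viewDir φ := by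
    intro x hx
    obtain ⟨φ, hφ⟩ := Plane.exists_eq_norm_smul_viewDir (x - c)
    exact ⟨φ, by rw [← hx, dist_eq_norm, ← hφ, add_sub_cancel]⟩
  obtain ⟨φ, hφ⟩ := hpolar z hz
  refine ⟨fun t => c + r • viewDir (φ + t), fun t => r • Plane.rot (viewDir (φ + t)),
    by simp only [hφ, add_zero], fun t => ?_, fun t => ⟨?_, ?_⟩, fun x hx => ?_⟩
  · rw [dist_self_add_left, norm_smul, norm_viewDir, mul_one, Real.norm_of_nonneg hr.le]
  · exact (((hasDerivAt_viewDir (φ + t)).comp_const_add φ t).const_smul r).const_add c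
  · rw [smul_ne_zero_iff, ← norm_ne_zero_iff (a := Plane.rot _), Plane.norm_rot, norm_viewDir]
    exact ⟨hr.ne', one_ne_zero⟩
  · obtain ⟨ψ, rfl⟩ := hpolar x hx
    obtain ⟨N, hN⟩ := exists_nat_gt ((φ - ψ) / (2 * Real.pi))
    rw [div_lt_iff₀ (by positivity)] at hN
    refine ⟨ψ + N * (2 * Real.pi) - φ, by linarith, ?_⟩
    simp only [add_sub_cancel, viewDir_add_nat_mul_two_pi]

namespace IsHyperplaneOrSphereEq

variable {g : Plane → ℝ} {z : Plane}

theorem exists_param (hg : IsHyperplaneOrSphereEq g) (hz : g z = 0) :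
    ∃ γ γ' : ℝ → Plane, γ 0 = z ∧ (∀ t, g (γ t) = 0) ∧
      (∀ t, HasDerivAt γ (γ' t) t ∧ γ' t ≠ 0) ∧
      ((∀ M : ℝ, ∃ t ≥ 0, M < ‖γ t‖) ∨ ∀ x, g x = 0 → ∃ t ≥ 0, γ t = x) := by
  rcases hg.hyperplane_or_sphere with ⟨v, d, hv, h⟩ | ⟨a, c, r, ha, hr, h⟩
  · simp only [h] at hz ⊢
    obtain ⟨γ, γ', h0, hmem, hderiv, hunbdd⟩ := exists_param_line hv hz
    exact ⟨γ, γ', h0, hmem, hderiv, Or.inl hunbdd⟩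
  · have hzero : ∀ x, g x = 0 ↔ dist x c = r := fun x => by
      rw [h, mul_eq_zero_iff_left ha, sub_eq_zero, sq_eq_sq₀ dist_nonneg hr.le]
    simp only [hzero] at hz ⊢
    obtain ⟨γ, γ', h0, hmem, hderiv, hcovers⟩ := exists_param_circle hr hz
    exact ⟨γ, γ', h0, hmem, hderiv, Or.inr hcovers⟩

theorem frequently_eq_zero (hg : IsHyperplaneOrSphereEq g) (hz : g z = 0) :
    ∃ᶠ x in 𝓝[≠] z, g x = 0 := by
  obtain ⟨γ, γ', rfl, hmem, hderiv, -⟩ := hg.exists_param hz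
  exact ((hderiv 0).1.tendsto_nhdsNE (hderiv 0).2).frequently (Filter.Frequently.of_forall hmem)

theorem exists_smul_eq_of_frequently {g' : Plane → ℝ} (hg : IsHyperplaneOrSphereEq g)
    (hg' : IsHyperplaneOrSphereEq g') (h : ∃ᶠ x in 𝓝[≠] z, g x = 0 ∧ g' x = 0) :
    ∃ l : ℝ, l ≠ 0 ∧ g' = l • g :=
  (hg.finite_setOf_zero_or_smul hg').resolve_left
    fun hfin => Set.Infinite.of_accPt (accPt_iff_frequently_nhdsNE.2 h) hfin

end IsHyperplaneOrSphereEq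

/-! ### Vertices, crossings and regular points -/

theorem mem_vertices_iff {A : Set Plane} {z : Plane} :
    z ∈ vertices A ↔ z ∈ frontier A ∧
      ¬ ∃ g, IsHyperplaneOrSphereEq g ∧ ∀ᶠ w in 𝓝 z, (w ∈ frontier A ↔ g w = 0) := by
  refine and_congr_right fun _ => not_congr ⟨?_, ?_⟩
  · rintro ⟨Γ, hΓ, V, hV, hAV⟩
    obtain ⟨g, hg, rfl⟩ := isLineOrCircle_iff.1 hΓ
    refine ⟨g, hg, Filter.mem_of_superset hV fun w hw => ?_⟩
    simpa [hw] using Set.ext_iff.1 hAV w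
  · rintro ⟨g, hg, hAV⟩
    exact ⟨_, isLineOrCircle_iff.2 ⟨g, hg, rfl⟩, _, hAV, Set.ext fun w =>
      and_congr_left fun hw => hw⟩

theorem mem_crossings_iff {A B : Set Plane} {z : Plane} :
    z ∈ crossings A B ↔ z ∈ A ∩ B ∧ ∀ᶠ w in 𝓝[≠] z, w ∉ A ∩ B := by
  constructor
  · rintro ⟨V, hV, h⟩
    refine ⟨(h.symm ▸ Set.mem_singleton z : z ∈ A ∩ B ∩ V).1, ?_⟩
    filter_upwards [self_mem_nhdsWithin, mem_nhdsWithin_of_mem_nhds hV] with w hwz hwV hw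
    exact hwz (h ▸ ⟨hw, hwV⟩ : w ∈ ({z} : Set Plane))
  · rintro ⟨hz, h⟩
    refine ⟨_, eventually_nhdsWithin_iff.1 h, Set.Subset.antisymm ?_ ?_⟩
    · rintro w ⟨hw, hwV⟩
      by_contra hne
      exact hwV hne hw
    · rintro w rfl
      exact ⟨hz, fun hne => absurd rfl hne⟩

namespace IsHyperplaneOrSphereEq

variable {g g' : Plane → ℝ} {A B : Set Plane} {z : Plane}

theorem notMem_vertices (hg : IsHyperplaneOrSphereEq g)
    (hA : ∀ᶠ w in 𝓝 z, (w ∈ frontier A ↔ g w = 0)) : z ∉ vertices A :=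
  fun hz => (mem_vertices_iff.1 hz).2 ⟨g, hg, hA⟩

theorem notMem_crossings (hg : IsHyperplaneOrSphereEq g) (hz : g z = 0)
    (hA : ∀ᶠ w in 𝓝 z, (w ∈ A ↔ g w = 0)) (hB : ∀ᶠ w in 𝓝 z, (w ∈ B ↔ g w = 0)) :
    z ∉ crossings A B := by
  intro hcross
  have hAB : ∀ᶠ w in 𝓝[≠] z, g w = 0 → w ∈ A ∩ B := by
    filter_upwards [nhdsWithin_le_nhds hA, nhdsWithin_le_nhds hB] with w hwA hwB hw
    exact ⟨hwA.2 hw, hwB.2 hw⟩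
  obtain ⟨w, hgw, hw, hnot⟩ := ((hg.frequently_eq_zero hz).and_eventually
    (hAB.and (mem_crossings_iff.1 hcross).2)).exists
  exact hnot (hw hgw)

theorem exists_smul_eq_of_notMem_crossings (hg : IsHyperplaneOrSphereEq g)
    (hg' : IsHyperplaneOrSphereEq g') (hz : z ∈ A ∩ B)
    (hA : ∀ᶠ w in 𝓝 z, (w ∈ A ↔ g w = 0)) (hB : ∀ᶠ w in 𝓝 z, (w ∈ B ↔ g' w = 0))
    (hcross : z ∉ crossings A B) : ∃ l : ℝ, l ≠ 0 ∧ g' = l • g := by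
  have hfreq : ∃ᶠ w in 𝓝[≠] z, w ∈ A ∩ B := fun h => hcross (mem_crossings_iff.2 ⟨hz, h⟩)
  refine hg.exists_smul_eq_of_frequently hg' (z := z) ((hfreq.and_eventually
    ((hA.and hB).filter_mono nhdsWithin_le_nhds)).mono ?_)
  exact fun w ⟨hw, hwA, hwB⟩ => ⟨hwA.1 hw.1, hwB.1 hw.2⟩

end IsHyperplaneOrSphereEq

/-- All functions of `F` that vanish at `z` are multiples of `g`, which is constant or the equation
of a line or circle belonging to `F`. -/
structure IsRegularAt (F : Set (Plane → ℝ)) (z : Plane) (g : Plane → ℝ) : Prop where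
  one_or_isHyperplaneOrSphereEq : (g = fun _ => 1) ∨ g ∈ F ∧ IsHyperplaneOrSphereEq g
  ne_zero_or_exists_smul : ∀ f ∈ F, f z ≠ 0 ∨ ∃ l : ℝ, f = l • g

namespace IsRegularAt

variable {F : Set (Plane → ℝ)} {z : Plane} {g : Plane → ℝ}

theorem changesSignAtZeros (h : IsRegularAt F z g) : ChangesSignAtZeros g := by
  rcases h.one_or_isHyperplaneOrSphereEq with rfl | ⟨-, hg⟩
  · exact ⟨continuous_const, fun _ h => absurd h one_ne_zero, fun _ h => absurd h one_ne_zero⟩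
  · exact hg.changesSignAtZeros

theorem isHyperplaneOrSphereEq (h : IsRegularAt F z g) (hz : g z = 0) :
    g ∈ F ∧ IsHyperplaneOrSphereEq g := by
  rcases h.one_or_isHyperplaneOrSphereEq with rfl | hg
  · exact absurd hz one_ne_zero
  · exact hg

end IsRegularAt

theorem exists_isRegularAt_of_infinite {F : Set (Plane → ℝ)} (hF : ∀ f ∈ F, IsIsotropicQuadratic f)
    {z : Plane}
    (hz : ∀ f ∈ F, ∀ f' ∈ F, f z = 0 → f' z = 0 → {x | f x = 0 ∧ f' x = 0}.Infinite) :
    ∃ g, IsRegularAt F z g := by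
  by_cases hall : ∀ f ∈ F, f z ≠ 0 ∨ f = 0
  · exact ⟨fun _ => 1, Or.inl rfl, fun f hf => (hall f hf).imp_right fun h => ⟨0, by simp [h]⟩⟩
  push Not at hall
  obtain ⟨g, hgF, hgz, hg0⟩ := hall
  have hcurve : ∀ f ∈ F, f z = 0 → f = 0 ∨ IsHyperplaneOrSphereEq f := fun f hf hfz =>
    (hF f hf).eq_zero_or_subsingleton_or_isHyperplaneOrSphereEq.imp_right fun h =>
      h.resolve_left fun hsub => hz f hf f hf hfz hfz (hsub.finite.subset fun _ hx => hx.1)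
  have hg := (hcurve g hgF hgz).resolve_left hg0
  refine ⟨g, Or.inr ⟨hgF, hg⟩, fun f hf => or_iff_not_imp_left.2 fun hfz => ?_⟩
  rw [not_not] at hfz
  rcases hcurve f hf hfz with rfl | hf'
  · exact ⟨0, (zero_smul ℝ g).symm⟩
  · obtain ⟨l, -, hl⟩ := (hg.finite_setOf_zero_or_smul hf').resolve_left (hz g hgF f hf hgz hfz)
    exact ⟨l, hl⟩

theorem exists_finite_forall_notMem_isRegularAt {F : Set (Plane → ℝ)} (hfin : F.Finite)
    (hF : ∀ f ∈ F, IsIsotropicQuadratic f) :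
    ∃ Z : Set Plane, Z.Finite ∧ ∀ z ∉ Z, ∃ g, IsRegularAt F z g := by
  let commonZeros (f f' : Plane → ℝ) : Set Plane := {x | f x = 0 ∧ f' x = 0}
  refine ⟨⋃₀ {s ∈ Set.image2 commonZeros F F | s.Finite},
    ((hfin.image2 _ hfin).subset (Set.sep_subset _ _)).sUnion fun s hs => hs.2, fun z hz => ?_⟩
  exact exists_isRegularAt_of_infinite hF fun f hf f' hf' hfz hfz' hcommon =>
    hz ⟨_, ⟨⟨f, hf, f', hf', rfl⟩, hcommon⟩, hfz, hfz'⟩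

theorem SignDetermined.signDeterminedAt {F : Set (Plane → ℝ)} {A : Set Plane}
    (hA : SignDetermined F A) (hfin : F.Finite) (hF : ∀ f ∈ F, IsIsotropicQuadratic f) {z : Plane}
    {g : Plane → ℝ} (hg : IsRegularAt F z g) : SignDeterminedAt g A z := by
  let V : Set Plane := {x | ∀ f ∈ F, f z ≠ 0 → SignType.sign (f x) = SignType.sign (f z)}
  have hV : V ∈ 𝓝 z := by
    refine (Filter.eventually_all_finite hfin).2 fun f hf => ?_
    by_cases hfz : f z = 0
    · simp [hfz]
    · exact (eventually_sign_eq (hF f hf).continuous.continuousAt hfz).mono fun x hx _ => hx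
  have hsign : ∀ x ∈ V, ∀ y ∈ V, SignType.sign (g x) = SignType.sign (g y) → x ∈ A → y ∈ A := by
    refine fun x hx y hy hxy => hA x y fun f hf => ?_
    rcases hg.ne_zero_or_exists_smul f hf with hfz | ⟨l, rfl⟩
    · rw [hx f hf hfz, hy f hf hfz]
    · simp only [Pi.smul_apply, smul_eq_mul, sign_mul, hxy]
  refine ⟨(SignType.sign ∘ g) '' (A ∩ V), Filter.mem_of_superset hV fun x hx => ⟨?_, ?_⟩⟩
  · exact fun hxA => ⟨x, ⟨hxA, hx⟩, rfl⟩
  · rintro ⟨y, ⟨hyA, hy⟩, hyx⟩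
    exact hsign y hy x hx hyx hyA

/-! ### Angles and wedges -/

section AngleLE

variable {V : Type*} [NormedAddCommGroup V] [InnerProductSpace ℝ V]

/-- The angle between `u` and `v` is at most `θ`. The formulation by the inner product also admits
zero vectors; the closed wedge with axis `viewDir α` and opening angle `θ` is
`{v | AngleLE (θ / 2) (viewDir α) v}`. -/
def AngleLE (θ : ℝ) (u v : V) : Prop := Real.cos θ * (‖u‖ * ‖v‖) ≤ inner ℝ u v

variable {θ θ' : ℝ} {u v w : V}

theorem angleLE_iff_angle_le (hu : u ≠ 0) (hv : v ≠ 0) (h0 : 0 ≤ θ) (hpi : θ ≤ Real.pi) :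
    AngleLE θ u v ↔ InnerProductGeometry.angle u v ≤ θ := by
  rw [AngleLE, ← InnerProductGeometry.cos_angle_mul_norm_mul_norm,
    mul_le_mul_iff_left₀ (mul_pos (norm_pos_iff.2 hu) (norm_pos_iff.2 hv))]
  exact Real.strictAntiOn_cos.le_iff_ge ⟨h0, hpi⟩
    ⟨InnerProductGeometry.angle_nonneg u v, InnerProductGeometry.angle_le_pi u v⟩

namespace AngleLE

theorem zero_left : AngleLE θ 0 v := by simp [AngleLE]

theorem zero_right : AngleLE θ u 0 := by simp [AngleLE]

theorem self : AngleLE θ u u := by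
  rw [AngleLE, real_inner_self_eq_norm_mul_norm]
  exact mul_le_of_le_one_left (by positivity) (Real.cos_le_one θ)

theorem symm (h : AngleLE θ u v) : AngleLE θ v u := by
  rwa [AngleLE, real_inner_comm, mul_comm ‖v‖]

theorem smul_right (h : AngleLE θ u v) {t : ℝ} (ht : 0 ≤ t) : AngleLE θ u (t • v) := by
  rw [AngleLE, norm_smul, Real.norm_of_nonneg ht, real_inner_smul_right, mul_left_comm ‖u‖,
    mul_left_comm]
  exact mul_le_mul_of_nonneg_left h ht

theorem add_right (hθ : 0 ≤ Real.cos θ) (hv : AngleLE θ u v) (hw : AngleLE θ u w) :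
    AngleLE θ u (v + w) := by
  calc Real.cos θ * (‖u‖ * ‖v + w‖)
      ≤ Real.cos θ * (‖u‖ * (‖v‖ + ‖w‖)) := by gcongr; exact norm_add_le v w
    _ = Real.cos θ * (‖u‖ * ‖v‖) + Real.cos θ * (‖u‖ * ‖w‖) := by ring
    _ ≤ inner ℝ u v + inner ℝ u w := add_le_add hv hw
    _ = inner ℝ u (v + w) := (inner_add_right u v w).symm

theorem trans (huv : AngleLE θ u v) (hvw : AngleLE θ' v w) (hv : v ≠ 0) (h0 : 0 ≤ θ) (h0' : 0 ≤ θ')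
    (hpi : θ + θ' ≤ Real.pi) : AngleLE (θ + θ') u w := by
  rcases eq_or_ne u 0 with rfl | hu
  · exact zero_left
  rcases eq_or_ne w 0 with rfl | hw
  · exact zero_right
  rw [angleLE_iff_angle_le hu hv h0 (by linarith)] at huv
  rw [angleLE_iff_angle_le hv hw h0' (by linarith)] at hvw
  rw [angleLE_iff_angle_le hu hw (by linarith) hpi]
  exact (InnerProductGeometry.angle_le_angle_add_angle u v w).trans (add_le_add huv hvw)

end AngleLE

theorem convex_setOf_angleLE (hθ : 0 ≤ Real.cos θ) (u : V) : Convex ℝ {v | AngleLE θ u v} :=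
  fun _ hv _ hw _ _ ha hb _ => (hv.smul_right ha).add_right hθ (hw.smul_right hb)

end AngleLE

theorem viewDir_ne_zero (α : ℝ) : viewDir α ≠ 0 :=
  norm_ne_zero_iff.1 ((norm_viewDir α).trans_ne one_ne_zero)

theorem inner_viewDir (α β : ℝ) : inner ℝ (viewDir α) (viewDir β) = Real.cos (α - β) := by
  rw [Plane.inner_eq, Real.cos_sub]
  rfl

theorem cos_le_cos_iff_abs_le {t a : ℝ} (h0 : 0 ≤ t) (hpi : t ≤ Real.pi) (ha : |a| ≤ Real.pi) :
    Real.cos t ≤ Real.cos a ↔ |a| ≤ t := by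
  rw [← Real.cos_abs a]
  exact Real.strictAntiOn_cos.le_iff_ge ⟨h0, hpi⟩ ⟨abs_nonneg a, ha⟩

theorem angleLE_iff_cos_le_cos {θ φ ψ : ℝ} {u v : Plane} (hu : u = ‖u‖ • viewDir φ)
    (hv : v = ‖v‖ • viewDir ψ) (hu0 : u ≠ 0) (hv0 : v ≠ 0) :
    AngleLE θ u v ↔ Real.cos θ ≤ Real.cos (φ - ψ) := by
  have hinner : inner ℝ u v = Real.cos (φ - ψ) * (‖u‖ * ‖v‖) := by
    conv_lhs => rw [hu, hv, real_inner_smul_left, real_inner_smul_right, inner_viewDir]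
    ring
  rw [AngleLE, hinner, mul_le_mul_iff_left₀ (mul_pos (norm_pos_iff.2 hu0) (norm_pos_iff.2 hv0))]

theorem exists_eq_norm_smul_viewDir_add_toReal (α : ℝ) (u : Plane) :
    ∃ a : Real.Angle, u = ‖u‖ • viewDir (α + a.toReal) := by
  obtain ⟨φ, hφ⟩ := u.exists_eq_norm_smul_viewDir
  refine ⟨((φ - α : ℝ) : Real.Angle), hφ.trans (congrArg (‖u‖ • ·) ?_)⟩
  refine (congrArg viewDir (add_sub_cancel α φ)).symm.trans (Plane.ext ?_ ?_)
  · simp only [viewDir, Real.cos_add, Real.Angle.cos_toReal, Real.Angle.sin_toReal,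
      Real.Angle.cos_coe, Real.Angle.sin_coe, PiLp.toLp_apply, Matrix.cons_val_zero]
  · simp only [viewDir, Real.sin_add, Real.Angle.cos_toReal, Real.Angle.sin_toReal,
      Real.Angle.cos_coe, Real.Angle.sin_coe, PiLp.toLp_apply, Matrix.cons_val_one]

theorem exists_eq_norm_smul_viewDir_add_of_pos {α : ℝ} {u : Plane}
    (h : 0 < inner ℝ (viewDir α) u) :
    ∃ a, |a| < Real.pi / 2 ∧ u = ‖u‖ • viewDir (α + a) := by
  obtain ⟨a, ha⟩ := exists_eq_norm_smul_viewDir_add_toReal α u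
  refine ⟨a.toReal, Real.Angle.cos_pos_iff_abs_toReal_lt_pi_div_two.1 ?_, ha⟩
  rw [ha, real_inner_smul_right, inner_viewDir, sub_add_cancel_left, Real.cos_neg,
    Real.Angle.cos_toReal] at h
  exact pos_of_mul_pos_right h (norm_nonneg u)

theorem viewDir_eq_norm_smul (β : ℝ) : viewDir β = ‖viewDir β‖ • viewDir β := by
  rw [norm_viewDir, one_smul]

theorem exists_wedge_of_inner_viewDir_pos {θ α : ℝ} (h0 : 0 ≤ θ) (hpi : θ ≤ Real.pi)
    {E : Set Plane} (hE : E.Finite) (hα : ∀ u ∈ E, 0 < inner ℝ (viewDir α) u)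
    (hangle : ∀ u ∈ E, ∀ v ∈ E, AngleLE θ u v) :
    ∃ β, ∀ u ∈ E, AngleLE (θ / 2) (viewDir β) u := by
  rcases E.eq_empty_or_nonempty with rfl | hne
  · exact ⟨0, fun u hu => absurd hu (Set.notMem_empty u)⟩
  have hne0 : ∀ u ∈ E, u ≠ 0 := by
    rintro u hu rfl
    exact absurd (hα 0 hu) (by rw [inner_zero_right]; exact lt_irrefl 0)
  choose! a ha hpolar using fun u hu =>
    exists_eq_norm_smul_viewDir_add_of_pos (hα u hu)
  have hdiff : ∀ u ∈ E, ∀ v ∈ E, |a u - a v| ≤ θ := by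
    intro u hu v hv
    have hle := (angleLE_iff_cos_le_cos (hpolar u hu) (hpolar v hv) (hne0 u hu) (hne0 v hv)).1
      (hangle u hu v hv)
    rw [add_sub_add_left_eq_sub] at hle
    refine (cos_le_cos_iff_abs_le h0 hpi ?_).1 hle
    linarith [abs_sub (a u) (a v), ha u hu, ha v hv]
  obtain ⟨P, hP, hPmax⟩ := Set.exists_max_image E a hE hne
  obtain ⟨Q, hQ, hQmin⟩ := Set.exists_min_image E a hE hne
  refine ⟨α + (a P + a Q) / 2, fun u hu => ?_⟩
  have hmid : |(a P + a Q) / 2 - a u| ≤ θ / 2 := by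
    rw [abs_le]
    constructor <;> linarith [hPmax u hu, hQmin u hu, (abs_le.1 (hdiff P hP Q hQ)).2]
  rw [angleLE_iff_cos_le_cos (viewDir_eq_norm_smul _) (hpolar u hu) (viewDir_ne_zero _)
    (hne0 u hu), add_sub_add_left_eq_sub]
  exact (cos_le_cos_iff_abs_le (by linarith) (by linarith) (by linarith)).2 hmid

theorem eventually_exists_wedge {θ : ℝ} (h0 : 0 ≤ θ) (hpi : θ < Real.pi) {E : Set Plane}
    (hE : E.Finite) {z : Plane} (hz : z ∉ E) {α : ℝ}
    (h : ∀ p ∈ E, AngleLE (θ / 2) (viewDir α) (p - z)) :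
    ∀ᶠ w in 𝓝 z, (∀ p ∈ E, ∀ q ∈ E, AngleLE θ (p - w) (q - w)) →
      ∃ β, ∀ p ∈ E, AngleLE (θ / 2) (viewDir β) (p - w) := by
  have hpos : ∀ p ∈ E, 0 < inner ℝ (viewDir α) (p - z) := by
    refine fun p hp => lt_of_lt_of_le (mul_pos ?_ (mul_pos ?_ ?_)) (h p hp)
    · exact Real.cos_pos_of_mem_Ioo ⟨by linarith, by linarith⟩
    · exact norm_pos_iff.2 (viewDir_ne_zero α)
    · exact norm_pos_iff.2 (sub_ne_zero.2 fun hpz => hz (hpz ▸ hp))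
  have hnear : ∀ᶠ w in 𝓝 z, ∀ p ∈ E, 0 < inner ℝ (viewDir α) (p - w) := by
    refine (Filter.eventually_all_finite hE).2 fun p hp => ?_
    have hcont : Continuous fun w : Plane => inner ℝ (viewDir α) (p - w) := by fun_prop
    exact hcont.continuousAt.eventually_const_lt (hpos p hp)
  filter_upwards [hnear] with w hw hpair
  have hwedge := exists_wedge_of_inner_viewDir_pos h0 hpi.le (hE.image (· - w))
    (Set.forall_mem_image.2 hw)
    (Set.forall_mem_image.2 fun p hp => Set.forall_mem_image.2 (hpair p hp))
  simpa only [Set.forall_mem_image] using hwedge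

theorem exists_wedge_pair_iff {θ : ℝ} (h0 : 0 ≤ θ) (hpi : θ < Real.pi) (u v : Plane) :
    (∃ α, AngleLE (θ / 2) (viewDir α) u ∧ AngleLE (θ / 2) (viewDir α) v) ↔ AngleLE θ u v := by
  constructor
  · rintro ⟨α, hu, hv⟩
    simpa only [add_halves] using
      hu.symm.trans hv (viewDir_ne_zero α) (by linarith) (by linarith) (by linarith)
  intro h
  obtain ⟨α, hu⟩ := u.exists_eq_norm_smul_viewDir
  obtain ⟨b, hv⟩ := exists_eq_norm_smul_viewDir_add_toReal α v
  rcases eq_or_ne u 0 with rfl | hu0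
  · exact ⟨α + b.toReal, .zero_right, hv ▸ AngleLE.self.smul_right (norm_nonneg v)⟩
  rcases eq_or_ne v 0 with rfl | hv0
  · exact ⟨α, hu ▸ AngleLE.self.smul_right (norm_nonneg u), .zero_right⟩
  rw [angleLE_iff_cos_le_cos hu hv hu0 hv0, sub_add_cancel_left, Real.cos_neg,
    cos_le_cos_iff_abs_le h0 hpi.le b.abs_toReal_le_pi] at h
  have hhalf : |b.toReal / 2| ≤ θ / 2 := by
    rw [abs_div, abs_two]
    exact div_le_div_of_nonneg_right h zero_le_two
  have hcos : Real.cos (θ / 2) ≤ Real.cos (b.toReal / 2) :=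
    (cos_le_cos_iff_abs_le (by linarith) (by linarith) (by linarith)).2 hhalf
  refine ⟨α + b.toReal / 2, ?_, ?_⟩
  · rwa [angleLE_iff_cos_le_cos (viewDir_eq_norm_smul _) hu (viewDir_ne_zero _) hu0,
      add_sub_cancel_left]
  · rwa [angleLE_iff_cos_le_cos (viewDir_eq_norm_smul _) hv (viewDir_ne_zero _) hv0,
      add_sub_add_left_eq_sub, half_sub, Real.cos_neg]

/-! ### Circles of inscribed angle -/

/-- The equation of the circle on which the chord `pq` has inscribed angle `θ`, on the side of the
chord where `cross (p - x) (q - x)` is positive. The mirror image in the chord is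
`aovFun θ q p`. -/
noncomputable def aovFun (θ : ℝ) (p q x : Plane) : ℝ :=
  Real.sin θ * inner ℝ (p - x) (q - x) - Real.cos θ * Plane.cross (p - x) (q - x)

/-- The centre of the circle with equation `aovFun θ p q`. -/
noncomputable def aovCenter (θ : ℝ) (p q : Plane) : Plane :=
  midpoint ℝ p q + (Real.cos θ / Real.sin θ / 2) • Plane.rot (q - p)

theorem aovFun_eq {θ : ℝ} (hs : Real.sin θ ≠ 0) (p q x : Plane) :
    aovFun θ p q x =
      Real.sin θ * (dist x (aovCenter θ p q) ^ 2 - (dist p q / (2 * Real.sin θ)) ^ 2) := by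
  rw [div_pow, Plane.dist_sq_eq, Plane.dist_sq_eq]
  simp only [aovFun, aovCenter, Plane.inner_eq, Plane.cross, midpoint_eq_smul_add, PiLp.add_apply,
    PiLp.sub_apply, PiLp.smul_apply, Plane.rot_zero, Plane.rot_one, invOf_eq_inv, smul_eq_mul]
  field_simp
  linear_combination -((p 0 - q 0) ^ 2 + (p 1 - q 1) ^ 2) * Real.sin_sq_add_cos_sq θ

theorem isHyperplaneOrSphereEq_aovFun {θ : ℝ} (hs : 0 < Real.sin θ) {p q : Plane} (hpq : p ≠ q) :
    IsHyperplaneOrSphereEq (aovFun θ p q) := by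
  rw [funext (aovFun_eq hs.ne' p q)]
  have hr : 0 < dist p q / (2 * Real.sin θ) := div_pos (dist_pos.2 hpq) (by positivity)
  exact (isHyperplaneOrSphereEq_dist_sq_sub (aovCenter θ p q) hr).const_mul hs.ne'

theorem setOf_aovFun_eq_sphere {θ : ℝ} (hs : 0 < Real.sin θ) (p q : Plane) :
    {x | aovFun θ p q x = 0} =
      Metric.sphere (aovCenter θ p q) (dist p q / (2 * Real.sin θ)) := by
  ext x
  rw [Set.mem_ofPred_eq, aovFun_eq hs.ne', mul_eq_zero_iff_left hs.ne', sub_eq_zero,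
    sq_eq_sq₀ dist_nonneg (by positivity), Metric.mem_sphere]

theorem aovFun_left (θ : ℝ) (p q : Plane) : aovFun θ p q p = 0 := by
  simp [aovFun, Plane.cross]

theorem aovFun_right (θ : ℝ) (p q : Plane) : aovFun θ p q q = 0 := by
  simp [aovFun, Plane.cross]

theorem exists_eq_midpoint_add_smul_rot {p q c : Plane} (hpq : p ≠ q) (hc : dist p c = dist q c) :
    ∃ s : ℝ, c = midpoint ℝ p q + s • Plane.rot (q - p) ∧
      dist p c ^ 2 = (1 / 4 + s ^ 2) * dist p q ^ 2 := by
  obtain ⟨s, hs⟩ := Plane.exists_eq_smul_rot_of_inner_eq_zero (sub_ne_zero.2 hpq.symm)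
    (AffineSubspace.mem_perpBisector_iff_inner_eq_zero'.1
      (AffineSubspace.mem_perpBisector_iff_dist_eq'.2 hc))
  obtain rfl := sub_eq_iff_eq_add'.1 hs
  refine ⟨s, rfl, ?_⟩
  simp only [Plane.dist_sq_eq, midpoint_eq_smul_add, PiLp.add_apply, PiLp.sub_apply,
    PiLp.smul_apply, Plane.rot_zero, Plane.rot_one, invOf_eq_inv, smul_eq_mul]
  ring

theorem OLSC.aovCirclesOfChord_eq {n u : ℕ} (I : OLSC n u) {p q : Plane} (hpq : p ≠ q) :
    I.aovCirclesOfChord p q = {{x | aovFun I.θ p q x = 0}, {x | aovFun I.θ q p x = 0}} := by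
  have hs := Real.sin_pos_of_pos_of_lt_pi I.θ_pos I.θ_lt_pi
  ext C
  constructor
  · rintro ⟨c, r, rfl, rfl, hp, hq⟩
    obtain ⟨s, rfl, hdist⟩ := exists_eq_midpoint_add_smul_rot hpq
      ((Metric.mem_sphere.1 hp).trans (Metric.mem_sphere.1 hq).symm)
    have hsq : s ^ 2 = (Real.cos I.θ / Real.sin I.θ / 2) ^ 2 := by
      rw [Metric.mem_sphere.1 hp] at hdist
      have hpq' : dist p q ≠ 0 := dist_ne_zero.2 hpq
      field_simp at hdist ⊢
      linear_combination -hdist / 4 - Real.sin_sq_add_cos_sq I.θ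
    rcases sq_eq_sq_iff_eq_or_eq_neg.1 hsq with rfl | rfl
    · exact Or.inl (setOf_aovFun_eq_sphere hs p q).symm
    · refine Or.inr ?_
      rw [Set.mem_singleton_iff, setOf_aovFun_eq_sphere hs, aovCenter, midpoint_comm, dist_comm,
        neg_smul, ← smul_neg, ← Plane.rot_neg, neg_sub]
  · rintro (rfl | rfl)
    · exact ⟨_, _, rfl, setOf_aovFun_eq_sphere hs p q, aovFun_left _ p q, aovFun_right _ p q⟩
    · exact ⟨_, _, rfl, dist_comm p q ▸ setOf_aovFun_eq_sphere hs q p, aovFun_right _ q p,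
        aovFun_left _ q p⟩

/-! ### Angle conditions in terms of signs -/

theorem Plane.abs_cross_eq_sin_angle_mul (u v : Plane) :
    |Plane.cross u v| = Real.sin (InnerProductGeometry.angle u v) * (‖u‖ * ‖v‖) := by
  have hsin := InnerProductGeometry.sin_angle_nonneg u v
  rw [← sq_eq_sq₀ (abs_nonneg _) (by positivity), sq_abs]
  have hinner := InnerProductGeometry.cos_angle_mul_norm_mul_norm u v
  linear_combination Plane.inner_sq_add_cross_sq u v - (‖u‖ * ‖v‖) ^ 2 *
    Real.sin_sq_add_cos_sq (InnerProductGeometry.angle u v) +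
    (Real.cos (InnerProductGeometry.angle u v) * (‖u‖ * ‖v‖) + inner ℝ u v) * hinner

theorem angleLE_iff_abs_cross_le {θ : ℝ} (h0 : 0 < θ) (hpi : θ < Real.pi) {u v : Plane} :
    AngleLE θ u v ↔ Real.cos θ * |Plane.cross u v| ≤ Real.sin θ * inner ℝ u v := by
  rcases eq_or_ne u 0 with rfl | hu
  · simp [AngleLE, Plane.cross]
  rcases eq_or_ne v 0 with rfl | hv
  · simp [AngleLE, Plane.cross]
  have hpos : 0 < ‖u‖ * ‖v‖ := mul_pos (norm_pos_iff.2 hu) (norm_pos_iff.2 hv)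
  have hsub : Real.sin θ * inner ℝ u v - Real.cos θ * |Plane.cross u v| =
      Real.sin (θ - InnerProductGeometry.angle u v) * (‖u‖ * ‖v‖) := by
    rw [Plane.abs_cross_eq_sin_angle_mul, ← InnerProductGeometry.cos_angle_mul_norm_mul_norm,
      Real.sin_sub]
    ring
  have hle := InnerProductGeometry.angle_le_pi u v
  have hnonneg := InnerProductGeometry.angle_nonneg u v
  rw [angleLE_iff_angle_le hu hv h0.le hpi.le, ← sub_nonneg, ← sub_nonneg (b := _ * |_|), hsub,
    mul_nonneg_iff_of_pos_right hpos]
  refine ⟨fun h => Real.sin_nonneg_of_nonneg_of_le_pi h (by linarith), fun h => ?_⟩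
  contrapose! h
  exact Real.sin_neg_of_neg_of_neg_pi_lt h (by linarith)

theorem aovFun_comm (θ : ℝ) (p q x : Plane) :
    aovFun θ q p x =
      Real.sin θ * inner ℝ (p - x) (q - x) + Real.cos θ * Plane.cross (p - x) (q - x) := by
  rw [aovFun, real_inner_comm, Plane.cross_swap]
  ring

theorem angleLE_iff_aovFun_nonneg {θ : ℝ} (h0 : 0 < θ) (hpi : θ < Real.pi) {p q x : Plane} :
    AngleLE θ (p - x) (q - x) ↔
      (0 ≤ Plane.cross (p - x) (q - x) → 0 ≤ aovFun θ p q x) ∧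
      (Plane.cross (p - x) (q - x) ≤ 0 → 0 ≤ aovFun θ q p x) := by
  rw [angleLE_iff_abs_cross_le h0 hpi, aovFun_comm θ p q x, aovFun, sub_nonneg]
  rcases lt_trichotomy (Plane.cross (p - x) (q - x)) 0 with h | h | h
  · simp [h.le, h.not_ge, abs_of_neg h, neg_le_iff_add_nonneg]
  · simp [h]
  · simp [h.le, h.not_ge, abs_of_pos h]

theorem eventually_aovFun_eq_zero_imp_angleLE {θ : ℝ} (h0 : 0 < θ) (hpi : θ < Real.pi)
    {p q z : Plane} (hpos : 0 < Plane.cross (p - z) (q - z)) :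
    ∀ᶠ w in 𝓝 z, aovFun θ p q w = 0 → AngleLE θ (p - w) (q - w) := by
  have hcont : Continuous fun w => Plane.cross (p - w) (q - w) := by
    unfold Plane.cross
    fun_prop
  filter_upwards [hcont.continuousAt.eventually_const_lt hpos] with w hw hzero
  exact (angleLE_iff_aovFun_nonneg h0 hpi).2 ⟨fun _ => hzero.ge, fun hle => absurd hw hle.not_gt⟩

theorem AngleLE.eventually_or_aovFun_eq_zero {θ : ℝ} (h0 : 0 < θ) (hpi : θ < Real.pi)
    {p q z : Plane} (hp : p ≠ z) (hq : q ≠ z) (h : AngleLE θ (p - z) (q - z)) :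
    (∀ᶠ w in 𝓝 z, AngleLE θ (p - w) (q - w)) ∨
      (aovFun θ p q z = 0 ∧ ∀ᶠ w in 𝓝 z, aovFun θ p q w = 0 → AngleLE θ (p - w) (q - w)) ∨
      aovFun θ q p z = 0 ∧ ∀ᶠ w in 𝓝 z, aovFun θ q p w = 0 → AngleLE θ (p - w) (q - w) := by
  rcases lt_or_eq_of_le h with hlt | heq
  · have hcont : Continuous fun w : Plane =>
        inner ℝ (p - w) (q - w) - Real.cos θ * (‖p - w‖ * ‖q - w‖) := by fun_prop
    refine Or.inl ((hcont.continuousAt.eventually_const_lt (sub_pos.2 hlt)).mono fun w hw => ?_)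
    exact (sub_pos.1 hw).le
  have hpos : 0 < ‖p - z‖ * ‖q - z‖ :=
    mul_pos (norm_pos_iff.2 (sub_ne_zero.2 hp)) (norm_pos_iff.2 (sub_ne_zero.2 hq))
  have hangle : InnerProductGeometry.angle (p - z) (q - z) = θ :=
    Real.injOn_cos ⟨InnerProductGeometry.angle_nonneg _ _, InnerProductGeometry.angle_le_pi _ _⟩
      ⟨h0.le, hpi.le⟩ (mul_right_cancel₀ hpos.ne'
        ((InnerProductGeometry.cos_angle_mul_norm_mul_norm _ _).trans heq.symm))
  have habs : |Plane.cross (p - z) (q - z)| = Real.sin θ * (‖p - z‖ * ‖q - z‖) := by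
    rw [Plane.abs_cross_eq_sin_angle_mul, hangle]
  have hcross : Plane.cross (p - z) (q - z) ≠ 0 := by
    rw [← abs_pos, habs]
    exact mul_pos (Real.sin_pos_of_pos_of_lt_pi h0 hpi) hpos
  rcases lt_or_gt_of_ne hcross with hneg | hpos
  · have hpos' : 0 < Plane.cross (q - z) (p - z) := by rwa [Plane.cross_swap, neg_pos]
    refine Or.inr (Or.inr ⟨?_, ?_⟩)
    · rw [aovFun_comm, ← neg_neg (Plane.cross _ _), ← abs_of_neg hneg, habs, ← heq]
      ring
    · exact (eventually_aovFun_eq_zero_imp_angleLE h0 hpi hpos').mono fun w hw hzero =>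
        (hw hzero).symm
  · refine Or.inr (Or.inl ⟨?_, eventually_aovFun_eq_zero_imp_angleLE h0 hpi hpos⟩)
    rw [aovFun, ← abs_of_pos hpos, habs, ← heq]
    ring

/-! ### Occlusion of a segment by a segment -/

/-- Twice the signed area of the triangle `pqx`. -/
def orient3 (p q x : Plane) : ℝ := Plane.cross (q - p) (x - p)

theorem orient3_eq (p q x : Plane) :
    orient3 p q x = (q 0 - p 0) * (x 1 - p 1) - (q 1 - p 1) * (x 0 - p 0) := rfl

theorem orient3_left (p q : Plane) : orient3 p q p = 0 := by
  rw [orient3_eq]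
  ring

theorem orient3_right (p q : Plane) : orient3 p q q = 0 := by
  rw [orient3_eq]
  ring

theorem orient3_rotate (p q x : Plane) : orient3 q x p = orient3 p q x := by
  simp only [orient3_eq]
  ring

theorem orient3_swap (p q x : Plane) : orient3 q p x = -orient3 p q x := by
  simp only [orient3_eq]
  ring

theorem orient3_add_add (s e x y : Plane) :
    orient3 e x y + orient3 x s y + orient3 s e y = orient3 s e x := by
  simp only [orient3_eq]
  ring

theorem orient3_lineMap (p q a b : Plane) (t : ℝ) :
    orient3 p q (AffineMap.lineMap a b t) =
      AffineMap.lineMap (orient3 p q a) (orient3 p q b) t := by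
  simp only [orient3_eq, AffineMap.lineMap_apply_module, PiLp.add_apply, PiLp.smul_apply,
    smul_eq_mul]
  ring

theorem orient3_smul_eq (s e x y : Plane) :
    orient3 s e x • y = orient3 e x y • s + orient3 x s y • e + orient3 s e y • x := by
  apply Plane.ext <;> simp only [orient3_eq, PiLp.add_apply, PiLp.smul_apply, smul_eq_mul] <;> ring

theorem exists_mem_openSegment_iff {s e x y : Plane} (hx : 0 < orient3 s e x) :
    (∃ p ∈ openSegment ℝ s e, y ∈ openSegment ℝ x p) ↔
      0 < orient3 s e y ∧ 0 < orient3 e x y ∧ 0 < orient3 x s y := by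
  simp only [openSegment_eq_image_lineMap]
  constructor
  · rintro ⟨_, ⟨a, ⟨ha0, ha1⟩, rfl⟩, c, ⟨hc0, hc1⟩, rfl⟩
    simp only [orient3_lineMap, orient3_left, orient3_right, orient3_rotate s e x,
      ← orient3_rotate x s e, AffineMap.lineMap_apply_ring', sub_self, mul_zero, add_zero,
      zero_sub, sub_zero]
    exact ⟨by nlinarith, by nlinarith [mul_pos hc0 (sub_pos.2 ha1)], by positivity⟩
  · rintro ⟨hC, hA, hB⟩
    set A := orient3 e x y
    set B := orient3 x s y
    set C := orient3 s e y
    set O := orient3 s e x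
    have hsum : A + B + C = O := orient3_add_add s e x y
    have hAB : 0 < A + B := add_pos hA hB
    refine ⟨AffineMap.lineMap s e (B / (A + B)), ⟨_, ⟨by positivity, ?_⟩, rfl⟩, (A + B) / O,
      ⟨by positivity, ?_⟩, smul_right_injective Plane hx.ne' ?_⟩
    · rw [div_lt_one hAB]
      linarith
    · rw [div_lt_one hx]
      linarith
    · refine Eq.trans ?_ (orient3_smul_eq s e x y).symm
      change O • _ = A • s + B • e + C • x
      simp only [AffineMap.lineMap_apply_module]
      match_scalars <;> field_simp <;> linarith

/-- The parameters in `[0, 1]` at which the affine function with end values `A` and `B` is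
positive. -/
def posParams (A B : ℝ) : Set ℝ := Set.Icc 0 1 ∩ AffineMap.lineMap A B ⁻¹' Set.Ioi 0

theorem convex_posParams (A B : ℝ) : Convex ℝ (posParams A B) :=
  (convex_Icc 0 1).inter ((convex_Ioi 0).affine_preimage _)

section PosParams

variable {A B C D t : ℝ}

theorem zero_mem_posParams (h : 0 < A) : 0 ∈ posParams A B :=
  ⟨Set.left_mem_Icc.2 zero_le_one, by simpa using h⟩

theorem one_mem_posParams (h : 0 < B) : 1 ∈ posParams A B :=
  ⟨Set.right_mem_Icc.2 zero_le_one, by simpa using h⟩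

theorem pos_or_pos_of_mem_posParams (h : t ∈ posParams A B) : 0 < A ∨ 0 < B := by
  by_contra! hAB
  exact (Set.mem_Ioi.1 h.2).not_ge <|
    Set.mem_Iic.1 ((convex_Iic (0 : ℝ)).lineMap_mem hAB.1 hAB.2 h.1)

theorem det_pos_of_mem_posParams (hA : 0 < A) (hC : C ≤ 0) (h : t ∈ posParams A B)
    (h' : t ∈ posParams C D) : 0 < A * D - B * C := by
  have hdet : A * AffineMap.lineMap C D t - C * AffineMap.lineMap A B t =
      t * (A * D - B * C) := by
    simp only [AffineMap.lineMap_apply_ring']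
    ring
  refine pos_of_mul_pos_right (hdet ▸ ?_) h.1.1
  linarith [mul_pos hA h'.2, mul_nonneg (neg_nonneg.2 hC) (le_of_lt h.2)]

theorem posParams_inter_nonempty_of_det_pos (hA : 0 < A) (hD : 0 < D)
    (hdet : 0 < A * D - B * C) : (posParams A B ∩ posParams C D).Nonempty := by
  rcases lt_or_ge 0 C with hC | hC
  · exact ⟨0, zero_mem_posParams hA, zero_mem_posParams hC⟩
  rcases lt_or_ge 0 B with hB | hB
  · exact ⟨1, one_mem_posParams hB, one_mem_posParams hD⟩
  have hS : 0 < A - C + (D - B) := by linarith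
  have hmem : (A - C) / (A - C + (D - B)) ∈ Set.Icc (0 : ℝ) 1 :=
    ⟨div_nonneg (by linarith) hS.le, (div_le_one hS).2 (by linarith)⟩
  refine ⟨_, ⟨hmem, ?_⟩, hmem, ?_⟩ <;>
    · rw [Set.mem_preimage, AffineMap.lineMap_apply_ring', Set.mem_Ioi]
      refine lt_of_lt_of_eq (div_pos hdet hS) ?_
      field_simp
      ring

theorem posParams_inter_nonempty_iff : (posParams A B ∩ posParams C D).Nonempty ↔
    (0 < A ∧ 0 < C) ∨ (0 < B ∧ 0 < D) ∨ (0 < A ∧ 0 < D ∧ 0 < A * D - B * C) ∨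
      (0 < C ∧ 0 < B ∧ A * D - B * C < 0) := by
  constructor
  · rintro ⟨t, ht, ht'⟩
    by_cases hA : 0 < A <;> by_cases hC : 0 < C
    · exact Or.inl ⟨hA, hC⟩
    · have hD := (pos_or_pos_of_mem_posParams ht').resolve_left hC
      exact Or.inr (Or.inr (Or.inl ⟨hA, hD, det_pos_of_mem_posParams hA (not_lt.1 hC) ht ht'⟩))
    · have hB := (pos_or_pos_of_mem_posParams ht).resolve_left hA
      have hdet := det_pos_of_mem_posParams hC (not_lt.1 hA) ht' ht
      exact Or.inr (Or.inr (Or.inr ⟨hC, hB, by linarith⟩))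
    · exact Or.inr (Or.inl ⟨(pos_or_pos_of_mem_posParams ht).resolve_left hA,
        (pos_or_pos_of_mem_posParams ht').resolve_left hC⟩)
  · rintro (⟨hA, hC⟩ | ⟨hB, hD⟩ | ⟨hA, hD, hdet⟩ | ⟨hC, hB, hdet⟩)
    · exact ⟨0, zero_mem_posParams hA, zero_mem_posParams hC⟩
    · exact ⟨1, one_mem_posParams hB, one_mem_posParams hD⟩
    · exact posParams_inter_nonempty_of_det_pos hA hD hdet
    · exact Set.inter_comm _ _ ▸ posParams_inter_nonempty_of_det_pos hC hB (by linarith)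

theorem posParams_inter_nonempty_of_sign_eq {A' B' C' D' : ℝ}
    (hA : SignType.sign A = SignType.sign A') (hB : SignType.sign B = SignType.sign B')
    (hC : SignType.sign C = SignType.sign C') (hD : SignType.sign D = SignType.sign D')
    (hdet : SignType.sign (A * D - B * C) = SignType.sign (A' * D' - B' * C'))
    (h : (posParams A B ∩ posParams C D).Nonempty) :
    (posParams A' B' ∩ posParams C' D').Nonempty := by
  rw [posParams_inter_nonempty_iff] at h ⊢
  rwa [pos_iff_of_sign_eq hA, pos_iff_of_sign_eq hB, pos_iff_of_sign_eq hC,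
    pos_iff_of_sign_eq hD, pos_iff_of_sign_eq hdet, neg_iff_of_sign_eq hdet] at h

end PosParams

theorem inter_inter_nonempty_of_convex {S₁ S₂ S₃ : Set ℝ} (h₁ : Convex ℝ S₁) (h₂ : Convex ℝ S₂)
    (h₃ : Convex ℝ S₃) (h₁₂ : (S₁ ∩ S₂).Nonempty) (h₁₃ : (S₁ ∩ S₃).Nonempty)
    (h₂₃ : (S₂ ∩ S₃).Nonempty) : (S₁ ∩ S₂ ∩ S₃).Nonempty := by
  have hconvex : ∀ i ∈ Finset.univ, Convex ℝ (![S₁, S₂, S₃] i) :=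
    fun i _ => by fin_cases i <;> assumption
  have hhelly := Convex.helly_theorem (by simp) hconvex fun I _ hI => by
    obtain ⟨i, j, hij, rfl⟩ := Finset.card_eq_two.1 (hI.trans (by simp))
    rw [Finset.set_biInter_insert, Finset.set_biInter_singleton]
    fin_cases i <;> fin_cases j <;> first | exact absurd rfl hij | assumption |
      (rw [Set.inter_comm]; assumption)
  simpa [Fin.forall_fin_succ, Set.Nonempty, and_assoc] using hhelly

/-- The locations from which the segment `ab` occludes the segment `se`. -/
def blocked (s e a b : Plane) : Set Plane :=
  {x | ∃ y ∈ segment ℝ a b, ∃ p ∈ openSegment ℝ s e, y ∈ openSegment ℝ x p}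

theorem blocked_swap (s e a b : Plane) : blocked e s a b = blocked s e a b := by
  simp only [blocked, openSegment_symm ℝ e s]

theorem mem_blocked_iff {s e a b x : Plane} (hx : 0 < orient3 s e x) :
    x ∈ blocked s e a b ↔
      (posParams (orient3 s e a) (orient3 s e b) ∩ posParams (orient3 e x a) (orient3 e x b) ∩
        posParams (orient3 x s a) (orient3 x s b)).Nonempty := by
  simp only [blocked, Set.mem_ofPred_eq, exists_mem_openSegment_iff hx, segment_eq_image_lineMap,
    Set.exists_mem_image, orient3_lineMap]
  refine exists_congr fun t => ?_
  simp only [posParams, Set.mem_inter_iff, Set.mem_preimage, Set.mem_Ioi]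
  tauto

section Determinants

variable (s e a b x : Plane)

theorem orient3_mul_sub_mul_right :
    orient3 s e a * orient3 e x b - orient3 s e b * orient3 e x a =
      orient3 s e x * orient3 e a b := by
  simp only [orient3_eq]
  ring

theorem orient3_mul_sub_mul_left :
    orient3 s e a * orient3 x s b - orient3 s e b * orient3 x s a =
      orient3 s e x * orient3 s b a := by
  simp only [orient3_eq]
  ring

theorem orient3_mul_sub_mul_apex :
    orient3 e x a * orient3 x s b - orient3 e x b * orient3 x s a =
      orient3 s e x * orient3 a b x := by
  simp only [orient3_eq]
  ring

end Determinants

theorem mem_blocked_of_sign_eq {s e a b x x' : Plane} (hx : 0 < orient3 s e x)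
    (hx' : 0 < orient3 s e x')
    (hea : SignType.sign (orient3 e x a) = SignType.sign (orient3 e x' a))
    (heb : SignType.sign (orient3 e x b) = SignType.sign (orient3 e x' b))
    (hsa : SignType.sign (orient3 x s a) = SignType.sign (orient3 x' s a))
    (hsb : SignType.sign (orient3 x s b) = SignType.sign (orient3 x' s b))
    (hab : SignType.sign (orient3 a b x) = SignType.sign (orient3 a b x'))
    (h : x ∈ blocked s e a b) : x' ∈ blocked s e a b := by
  rw [mem_blocked_iff hx] at h
  rw [mem_blocked_iff hx']
  obtain ⟨t, ⟨hse, he⟩, hs⟩ := h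
  refine inter_inter_nonempty_of_convex (convex_posParams _ _) (convex_posParams _ _)
    (convex_posParams _ _) ?_ ?_ ?_
  · refine posParams_inter_nonempty_of_sign_eq rfl rfl hea heb ?_ ⟨t, hse, he⟩
    simp only [orient3_mul_sub_mul_right, sign_mul, sign_pos hx, sign_pos hx']
  · refine posParams_inter_nonempty_of_sign_eq rfl rfl hsa hsb ?_ ⟨t, hse, hs⟩
    simp only [orient3_mul_sub_mul_left, sign_mul, sign_pos hx, sign_pos hx']
  · refine posParams_inter_nonempty_of_sign_eq hea heb hsa hsb ?_ ⟨t, he, hs⟩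
    simp only [orient3_mul_sub_mul_apex, sign_mul, sign_pos hx, sign_pos hx', hab]

/-! ### Distance to a segment -/

theorem dist_le_dist_lineMap_of_inner_nonpos {V : Type*} [NormedAddCommGroup V]
    [InnerProductSpace ℝ V] {s e x : V} (h : inner ℝ (x - s) (e - s) ≤ 0) {t : ℝ} (ht : 0 ≤ t) :
    dist x s ≤ dist x (AffineMap.lineMap s e t) := by
  have hsq := norm_sub_sq_real (x - s) (t • (e - s))
  rw [real_inner_smul_right] at hsq
  rw [dist_eq_norm, dist_eq_norm, AffineMap.lineMap_apply, vsub_eq_sub, vadd_eq_add, add_comm,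
    ← sub_sub, ← sq_le_sq₀ (norm_nonneg _) (norm_nonneg _), hsq]
  nlinarith [mul_nonneg ht (neg_nonneg.2 h), sq_nonneg ‖t • (e - s)‖]

theorem dist_lineMap_sq_mul_dist_sq (s e x : Plane) (t : ℝ) :
    dist x (AffineMap.lineMap s e t) ^ 2 * dist s e ^ 2 =
      orient3 s e x ^ 2 + (inner ℝ (x - s) (e - s) - t * dist s e ^ 2) ^ 2 := by
  simp only [Plane.dist_sq_eq, Plane.inner_eq, orient3_eq, AffineMap.lineMap_apply_module,
    PiLp.add_apply, PiLp.sub_apply, PiLp.smul_apply, smul_eq_mul]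
  ring

theorem inner_sub_add_inner_sub_eq_dist_sq (s e x : Plane) :
    inner ℝ (x - s) (e - s) + inner ℝ (e - x) (e - s) = dist s e ^ 2 := by
  rw [← inner_add_left, add_comm, sub_add_sub_cancel, real_inner_self_eq_norm_sq, dist_comm,
    dist_eq_norm]

theorem exists_dist_lineMap_mul_eq_abs_orient3 {s e x : Plane} (hse : s ≠ e)
    (hs : 0 ≤ inner ℝ (x - s) (e - s)) (he : 0 ≤ inner ℝ (e - x) (e - s)) :
    ∃ t ∈ Set.Icc (0 : ℝ) 1, dist x (AffineMap.lineMap s e t) * dist s e = |orient3 s e x| := by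
  have hL : 0 < dist s e ^ 2 := pow_pos (dist_pos.2 hse) 2
  refine ⟨inner ℝ (x - s) (e - s) / dist s e ^ 2, ⟨by positivity, ?_⟩, ?_⟩
  · rw [div_le_one hL]
    linarith [inner_sub_add_inner_sub_eq_dist_sq s e x]
  · rw [← abs_of_nonneg (mul_nonneg dist_nonneg dist_nonneg), ← sq_eq_sq_iff_abs_eq_abs, mul_pow,
      dist_lineMap_sq_mul_dist_sq, div_mul_cancel₀ _ hL.ne', sub_self]
    ring

theorem abs_orient3_le_dist_lineMap_mul (s e x : Plane) (t : ℝ) :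
    |orient3 s e x| ≤ dist x (AffineMap.lineMap s e t) * dist s e := by
  refine abs_le_of_sq_le_sq ?_ (by positivity)
  rw [mul_pow, dist_lineMap_sq_mul_dist_sq]
  exact le_add_of_nonneg_right (sq_nonneg _)

theorem forall_mem_segment_le_dist_iff {s e : Plane} (hse : s ≠ e) (R : ℝ) (x : Plane) :
    (∀ p ∈ segment ℝ s e, R ≤ dist x p) ↔ R ≤ dist x s ∧ R ≤ dist x e ∧
      (0 ≤ inner ℝ (x - s) (e - s) → 0 ≤ inner ℝ (e - x) (e - s) →
        R * dist s e ≤ |orient3 s e x|) := by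
  have hL : 0 < dist s e := dist_pos.2 hse
  constructor
  · refine fun h => ⟨h s (left_mem_segment ℝ s e), h e (right_mem_segment ℝ s e), fun hs he => ?_⟩
    obtain ⟨t, ht, heq⟩ := exists_dist_lineMap_mul_eq_abs_orient3 hse hs he
    rw [← heq]
    gcongr
    exact h _ (segment_eq_image_lineMap ℝ s e ▸ Set.mem_image_of_mem _ ht)
  · rintro ⟨hs, he, hperp⟩ p hp
    rw [segment_eq_image_lineMap] at hp
    obtain ⟨t, ht, rfl⟩ := hp
    rcases le_total (inner ℝ (x - s) (e - s)) 0 with hks | hks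
    · exact hs.trans (dist_le_dist_lineMap_of_inner_nonpos hks ht.1)
    rcases le_total (inner ℝ (e - x) (e - s)) 0 with hke | hke
    · rw [← AffineMap.lineMap_apply_one_sub]
      refine he.trans (dist_le_dist_lineMap_of_inner_nonpos ?_ (sub_nonneg.2 ht.2))
      rwa [← inner_neg_neg, neg_sub, neg_sub]
    · exact le_of_mul_le_mul_right
        ((hperp hks hke).trans (abs_orient3_le_dist_lineMap_mul s e x t)) hL

/-! ### The boundary curves of a camera placement field -/

theorem cross_sub_eq_orient3 (s e x : Plane) : Plane.cross (s - x) (e - x) = orient3 s e x := by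
  simp only [orient3_eq, Plane.cross, PiLp.sub_apply]
  ring

theorem orient3_eq_inner_add (p q x : Plane) :
    orient3 p q x = inner ℝ (Plane.rot (q - p)) x + -inner ℝ (Plane.rot (q - p)) p := by
  rw [← sub_eq_add_neg, ← inner_sub_right, Plane.inner_rot, orient3]

namespace OLSTarget

variable (T : OLSTarget)

/-- The signed height of a point over the line of a target (scaled by the norm of the orientation
vector), positive in front of the target. -/
noncomputable def front (x : Plane) : ℝ :=
  inner ℝ T.orient (x - midpoint ℝ T.start T.finish)

theorem front_eq (x : Plane) : T.front x = inner ℝ T.orient (x - T.start) := by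
  rw [front, ← sub_sub_sub_cancel_right x _ T.start, midpoint_sub_left, inner_sub_right,
    real_inner_smul_right, T.orient_perp, mul_zero, sub_zero]

theorem front_start : T.front T.start = 0 := by
  rw [front_eq, sub_self, inner_zero_right]

theorem front_finish : T.front T.finish = 0 := by
  rw [front_eq, T.orient_perp]

theorem front_midpoint : T.front (midpoint ℝ T.start T.finish) = 0 := by
  rw [front, sub_self, inner_zero_right]

theorem front_sub (x y : Plane) : T.front x - T.front y = inner ℝ T.orient (x - y) := by
  rw [front, front, ← inner_sub_right, sub_sub_sub_cancel_right]

theorem continuous_front : Continuous T.front := by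
  unfold front
  fun_prop

theorem angle_lt_pi_div_two_iff (x : Plane) :
    InnerProductGeometry.angle T.orient (x - midpoint ℝ T.start T.finish) < Real.pi / 2 ↔
      0 < T.front x := by
  rw [InnerProductGeometry.angle, Real.arccos_lt_pi_div_two, front]
  refine ⟨fun h => ?_, fun h => div_pos h ?_⟩
  · by_contra! hle
    exact h.not_ge (div_nonpos_of_nonpos_of_nonneg hle (by positivity))
  · exact h.trans_le (real_inner_le_norm _ _)

theorem exists_front_eq_mul_orient3 : ∃ l : ℝ, 0 < l ∧
    ((∀ x, T.front x = l * orient3 T.start T.finish x) ∨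
      ∀ x, T.front x = l * orient3 T.finish T.start x) := by
  obtain ⟨l, hl⟩ := Plane.exists_eq_smul_rot_of_inner_eq_zero
    (sub_ne_zero.2 T.start_ne_finish.symm) (by rw [real_inner_comm]; exact T.orient_perp)
  have hfront : ∀ x, T.front x = l * orient3 T.start T.finish x := fun x => by
    rw [front_eq, hl, real_inner_smul_left, Plane.inner_rot, orient3]
  rcases lt_trichotomy l 0 with hneg | rfl | hpos
  · exact ⟨-l, neg_pos.2 hneg, Or.inr fun x => by rw [hfront, orient3_swap, mul_neg, neg_mul]⟩
  · exact absurd (by rw [hl, zero_smul]) T.orient_ne_zero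
  · exact ⟨l, hpos, Or.inl hfront⟩

theorem exists_mem_sphere_front_neg {c m : Plane} {r : ℝ} (hm : m ∈ Metric.ball c r)
    (hfront : T.front m = 0) : ∃ x ∈ Metric.sphere c r, T.front x < 0 := by
  have hD : 0 < ‖T.orient‖ := norm_pos_iff.2 T.orient_ne_zero
  have hr : 0 ≤ r := dist_nonneg.trans (Metric.mem_ball.1 hm).le
  refine ⟨c - (r / ‖T.orient‖) • T.orient, ?_, ?_⟩
  · rw [mem_sphere_iff_norm, sub_sub_cancel_left, norm_neg, norm_smul, norm_div, norm_norm,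
      div_mul_cancel₀ _ hD.ne', Real.norm_of_nonneg hr]
  · have hc : T.front c < ‖T.orient‖ * r := calc
      T.front c = inner ℝ T.orient (c - m) := by rw [← front_sub, hfront, sub_zero]
      _ ≤ ‖T.orient‖ * ‖c - m‖ := real_inner_le_norm _ _
      _ < ‖T.orient‖ * r :=
        mul_lt_mul_of_pos_left (by rwa [← dist_eq_norm, dist_comm]) hD
    have hstep := T.front_sub (c - (r / ‖T.orient‖) • T.orient) c
    rw [sub_sub_cancel_left, inner_neg_right, real_inner_smul_right,
      real_inner_self_eq_norm_mul_norm, ← mul_assoc, div_mul_cancel₀ _ hD.ne'] at hstep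
    linarith

end OLSTarget

/-- Equations of the lines bounding the region in which `ab` occludes `se`: they join an end point
of one segment to an end point of the other, or contain `ab`. -/
def occlusionLines (s e a b : Plane) : Set (Plane → ℝ) :=
  {orient3 a e, orient3 b e, orient3 s a, orient3 s b, orient3 a b}

theorem signDetermined_setOf_notMem_blocked (s e : Plane) (S : Set (Plane × Plane)) :
    SignDetermined (insert (orient3 s e) (⋃ σ ∈ S, occlusionLines s e σ.1 σ.2))
      {x | 0 < orient3 s e x ∧ ∀ σ ∈ S, x ∉ blocked s e σ.1 σ.2} := by
  rintro x y hsign ⟨hx, hclear⟩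
  have hy := (pos_iff_of_sign_eq (hsign _ (Set.mem_insert _ _))).1 hx
  refine ⟨hy, fun σ hσ hblocked => hclear σ hσ ?_⟩
  have hlines : ∀ f ∈ occlusionLines s e σ.1 σ.2, SignType.sign (f x) = SignType.sign (f y) :=
    fun f hf => hsign f (Or.inr (Set.mem_biUnion hσ hf))
  simp only [occlusionLines, Set.mem_insert_iff, Set.mem_singleton_iff, forall_eq_or_imp,
    forall_eq] at hlines
  obtain ⟨hea, heb, hsa, hsb, hab⟩ := hlines
  refine mem_blocked_of_sign_eq hy hx ?_ ?_ ?_ ?_ hab.symm hblocked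
  · rw [orient3_rotate σ.1 e x, orient3_rotate σ.1 e y, hea]
  · rw [orient3_rotate σ.2 e x, orient3_rotate σ.2 e y, heb]
  · rw [← orient3_rotate x s, ← orient3_rotate y s, hsa]
  · rw [← orient3_rotate x s, ← orient3_rotate y s, hsb]

theorem not_isBounded_setOf_inner_add_eq_zero {V : Type*} [NormedAddCommGroup V]
    [InnerProductSpace ℝ V] {v : V} {d : ℝ} (h : {x | inner ℝ v x + d = 0}.Nontrivial) :
    ¬ Bornology.IsBounded {x | inner ℝ v x + d = 0} := by
  obtain ⟨x, hx, y, hy, hxy⟩ := h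
  rw [Set.mem_ofPred_eq] at hx hy
  intro hbounded
  obtain ⟨R, hR⟩ := hbounded.subset_ball x
  have hw : ‖y - x‖ ≠ 0 := norm_ne_zero_iff.2 (sub_ne_zero.2 hxy.symm)
  have hmem : x + (R / ‖y - x‖) • (y - x) ∈ {x | inner ℝ v x + d = 0} := by
    rw [Set.mem_ofPred_eq, inner_add_right, real_inner_smul_right, inner_sub_right]
    linear_combination (1 - R / ‖y - x‖) * hx + R / ‖y - x‖ * hy
  have hdist := Metric.mem_ball.1 (hR hmem)
  rw [dist_self_add_left, norm_smul, norm_div, norm_norm, div_mul_cancel₀ _ hw] at hdist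
  exact hdist.not_ge (le_abs_self R)

namespace OLSC

variable {n u : ℕ} (I : OLSC n u) (i : Fin n)

theorem sin_θ_pos : 0 < Real.sin I.θ :=
  Real.sin_pos_of_pos_of_lt_pi I.θ_pos I.θ_lt_pi

/-- The end point pairs of the segments that may occlude target `i`. -/
def occSegs : Set (Plane × Plane) :=
  {σ | (∃ j, j ≠ i ∧ σ = ((I.target j).start, (I.target j).finish)) ∨ ∃ k, σ ∈ I.obstacle k}

theorem finite_occSegs : (I.occSegs i).Finite := by
  refine ((Set.finite_range fun j => ((I.target j).start, (I.target j).finish)).union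
    (Set.finite_iUnion fun k => List.finite_toSet (I.obstacle k))).subset ?_
  rintro σ (⟨j, -, rfl⟩ | ⟨k, hk⟩)
  · exact Or.inl ⟨j, rfl⟩
  · exact Or.inr (Set.mem_iUnion.2 ⟨k, hk⟩)

theorem mem_occluders_iff (y : Plane) :
    y ∈ I.occluders i ↔ ∃ σ ∈ I.occSegs i, y ∈ segment ℝ σ.1 σ.2 := by
  constructor
  · rintro (⟨j, hj, hy⟩ | ⟨k, σ, hk, hy⟩)
    · exact ⟨_, Or.inl ⟨j, hj, rfl⟩, hy⟩
    · exact ⟨σ, Or.inr ⟨k, hk⟩, hy⟩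
  · rintro ⟨σ, ⟨j, hj, rfl⟩ | ⟨k, hk⟩, hy⟩
    · exact Or.inl ⟨j, hj, hy⟩
    · exact Or.inr ⟨k, σ, hk, hy⟩

theorem strictFrontalView_iff (x : Plane) :
    I.StrictFrontalView i x ↔ 0 < (I.target i).front x ∧
      ∀ σ ∈ I.occSegs i, x ∉ blocked (I.target i).start (I.target i).finish σ.1 σ.2 := by
  rw [StrictFrontalView, OLSTarget.angle_lt_pi_div_two_iff]
  simp only [Set.disjoint_left, mem_occluders_iff, blocked, Set.mem_ofPred_eq]
  refine and_congr_right fun _ => ⟨?_, ?_⟩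
  · rintro h σ hσ ⟨y, hy, p, hp, hyp⟩
    exact h p hp hyp ⟨σ, hσ, hy⟩
  · rintro h p hp y hyp ⟨σ, hσ, hy⟩
    exact h σ hσ ⟨y, hy, p, hp, hyp⟩

/-- Equations of the lines that bound the locations with a strict frontal view of target `i`, whose
end points are `s` and `e` in the order seen from the front. -/
def viewLines (s e : Plane) : Set (Plane → ℝ) :=
  insert (orient3 s e) (⋃ σ ∈ I.occSegs i, occlusionLines s e σ.1 σ.2)

/-- Equations of the lines that bound the locations at distance at least `Rmin` from target `i`. -/
noncomputable def rangeLines : Set (Plane → ℝ) :=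
  let s := (I.target i).start
  let e := (I.target i).finish
  {orient3 s e, fun x => inner ℝ (x - s) (e - s), fun x => inner ℝ (e - x) (e - s),
    fun x => orient3 s e x - I.Rmin * dist s e, fun x => orient3 s e x + I.Rmin * dist s e}

/-- Equations of the circles that bound the locations satisfying the range and angle of view
constraints of target `i`. -/
noncomputable def rangeCircles : Set (Plane → ℝ) :=
  let s := (I.target i).start
  let e := (I.target i).finish
  {fun x => dist x s ^ 2 - I.Rmax ^ 2, fun x => dist x e ^ 2 - I.Rmax ^ 2,
    fun x => dist x s ^ 2 - I.Rmin ^ 2, fun x => dist x e ^ 2 - I.Rmin ^ 2,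
    aovFun I.θ s e, aovFun I.θ e s}

/-- Equations of lines and circles containing the boundary of the camera placement field of target
`i`. -/
noncomputable def boundaryFuns : Set (Plane → ℝ) :=
  I.viewLines i (I.target i).start (I.target i).finish ∪
    I.viewLines i (I.target i).finish (I.target i).start ∪ I.rangeLines i ∪ I.rangeCircles i

theorem finite_viewLines (s e : Plane) : (I.viewLines i s e).Finite :=
  .insert _ <| (I.finite_occSegs i).biUnion fun σ _ => by simp [occlusionLines]

theorem finite_boundaryFuns : (I.boundaryFuns i).Finite :=
  (((I.finite_viewLines i _ _).union (I.finite_viewLines i _ _)).union (by simp [rangeLines])).union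
    (by simp [rangeCircles])

theorem exists_eq_inner_add_of_mem_viewLines {s e : Plane} {f : Plane → ℝ}
    (hf : f ∈ I.viewLines i s e) : ∃ v d, f = fun x => inner ℝ v x + d := by
  have horient : ∀ p q, ∃ v d, orient3 p q = fun x => inner ℝ v x + d :=
    fun p q => ⟨_, _, funext (orient3_eq_inner_add p q)⟩
  rcases hf with rfl | hf
  · exact horient s e
  · obtain ⟨σ, -, rfl | rfl | rfl | rfl | rfl⟩ := Set.mem_iUnion₂.1 hf <;> exact horient _ _

theorem exists_eq_inner_add_of_mem_rangeLines {f : Plane → ℝ} (hf : f ∈ I.rangeLines i) :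
    ∃ v d, f = fun x => inner ℝ v x + d := by
  set s := (I.target i).start
  set e := (I.target i).finish
  rcases hf with rfl | rfl | rfl | rfl | rfl
  · exact ⟨_, _, funext (orient3_eq_inner_add s e)⟩
  · refine ⟨e - s, -inner ℝ (e - s) s, funext fun x => ?_⟩
    rw [real_inner_comm, inner_sub_right, sub_eq_add_neg]
  · refine ⟨-(e - s), inner ℝ (e - s) e, funext fun x => ?_⟩
    rw [real_inner_comm, inner_sub_right, sub_eq_neg_add, inner_neg_left]
  · exact ⟨_, _, funext fun x => by rw [orient3_eq_inner_add, add_sub_assoc]⟩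
  · exact ⟨_, _, funext fun x => by rw [orient3_eq_inner_add, add_assoc]⟩

theorem exists_eq_dist_sq_sub_of_mem_rangeCircles {f : Plane → ℝ} (hf : f ∈ I.rangeCircles i) :
    ∃ l c r, l ≠ 0 ∧ (f = fun x => l * (dist x c ^ 2 - r ^ 2)) ∧
      (r = 0 ∨ ∃ m ∈ Metric.ball c r, (I.target i).front m = 0) := by
  have hdist : ∀ c r, 0 ≤ r → (I.target i).front c = 0 → ∃ l c' r', l ≠ 0 ∧
      ((fun x : Plane => dist x c ^ 2 - r ^ 2) = fun x => l * (dist x c' ^ 2 - r' ^ 2)) ∧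
        (r' = 0 ∨ ∃ m ∈ Metric.ball c' r', (I.target i).front m = 0) := fun c r hr hc =>
    ⟨1, c, r, one_ne_zero, by simp only [one_mul], hr.eq_or_lt.imp Eq.symm fun hr =>
      ⟨c, Metric.mem_ball_self hr, hc⟩⟩
  have haov : ∀ p q, p ≠ q → (I.target i).front (midpoint ℝ p q) = 0 → ∃ l c r, l ≠ 0 ∧
      (aovFun I.θ p q = fun x => l * (dist x c ^ 2 - r ^ 2)) ∧
        (r = 0 ∨ ∃ m ∈ Metric.ball c r, (I.target i).front m = 0) := fun p q hpq hm => by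
    refine ⟨_, _, _, I.sin_θ_pos.ne', funext (aovFun_eq I.sin_θ_pos.ne' p q), Or.inr ⟨_, ?_, hm⟩⟩
    have hsphere := setOf_aovFun_eq_sphere I.sin_θ_pos p q
    exact openSegment_subset_ball_of_ne
      (Metric.sphere_subset_closedBall (hsphere ▸ aovFun_left _ _ _))
      (Metric.sphere_subset_closedBall (hsphere ▸ aovFun_right _ _ _)) hpq
      (midpoint_mem_openSegment _ _)
  have hne := (I.target i).start_ne_finish
  have hmid := (I.target i).front_midpoint
  have hmax := I.Rmin_nonneg.trans I.Rmin_le_Rmax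
  rcases hf with rfl | rfl | rfl | rfl | rfl | rfl
  · exact hdist _ _ hmax (I.target i).front_start
  · exact hdist _ _ hmax (I.target i).front_finish
  · exact hdist _ _ I.Rmin_nonneg (I.target i).front_start
  · exact hdist _ _ I.Rmin_nonneg (I.target i).front_finish
  · exact haov _ _ hne hmid
  · exact haov _ _ hne.symm (midpoint_comm (R := ℝ) (I.target i).start _ ▸ hmid)

theorem boundaryFuns_line_or_circle {f : Plane → ℝ} (hf : f ∈ I.boundaryFuns i) :
    (∃ v d, f = fun x => inner ℝ v x + d) ∨
      ∃ l c r, l ≠ 0 ∧ (f = fun x => l * (dist x c ^ 2 - r ^ 2)) ∧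
        (r = 0 ∨ ∃ m ∈ Metric.ball c r, (I.target i).front m = 0) := by
  rcases hf with ((hf | hf) | hf) | hf
  · exact Or.inl (I.exists_eq_inner_add_of_mem_viewLines i hf)
  · exact Or.inl (I.exists_eq_inner_add_of_mem_viewLines i hf)
  · exact Or.inl (I.exists_eq_inner_add_of_mem_rangeLines i hf)
  · exact Or.inr (I.exists_eq_dist_sq_sub_of_mem_rangeCircles i hf)

theorem isIsotropicQuadratic_of_mem_boundaryFuns {f : Plane → ℝ} (hf : f ∈ I.boundaryFuns i) :
    IsIsotropicQuadratic f := by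
  rcases I.boundaryFuns_line_or_circle i hf with ⟨v, d, rfl⟩ | ⟨l, c, r, -, rfl, -⟩
  · exact isIsotropicQuadratic_inner_add v d
  · exact (isIsotropicQuadratic_dist_sq_sub c (r ^ 2)).const_mul l

theorem exists_front_neg_of_isBounded {f : Plane → ℝ} (hf : f ∈ I.boundaryFuns i)
    (hbounded : Bornology.IsBounded {x | f x = 0}) (hzeros : {x | f x = 0}.Nontrivial) :
    ∃ x, f x = 0 ∧ (I.target i).front x < 0 := by
  rcases I.boundaryFuns_line_or_circle i hf with ⟨v, d, rfl⟩ | ⟨l, c, r, hl, rfl, hr⟩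
  · exact absurd hbounded (not_isBounded_setOf_inner_add_eq_zero hzeros)
  have hzero : ∀ x, l * (dist x c ^ 2 - r ^ 2) = 0 ↔ dist x c ^ 2 = r ^ 2 := fun x => by
    rw [mul_eq_zero_iff_left hl, sub_eq_zero]
  simp only [hzero] at hzeros ⊢
  rcases hr with rfl | ⟨m, hm, hfront⟩
  · obtain ⟨x, hx, y, hy, hxy⟩ := hzeros
    simp only [Set.mem_ofPred_eq, ne_eq, OfNat.ofNat_ne_zero, not_false_eq_true, zero_pow,
      pow_eq_zero_iff, dist_eq_zero] at hx hy
    exact absurd (hx.trans hy.symm) hxy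
  · obtain ⟨x, hx, hneg⟩ := (I.target i).exists_mem_sphere_front_neg hm hfront
    exact ⟨x, by rw [Metric.mem_sphere.1 hx], hneg⟩

theorem signDetermined_strictFrontalView :
    SignDetermined (I.boundaryFuns i) {x | I.StrictFrontalView i x} := by
  obtain ⟨l, hl, hfront | hfront⟩ := (I.target i).exists_front_eq_mul_orient3
  · simp only [strictFrontalView_iff, hfront, mul_pos_iff_of_pos_left hl]
    exact (signDetermined_setOf_notMem_blocked _ _ _).mono fun f hf => Or.inl (Or.inl (Or.inl hf))
  · simp only [strictFrontalView_iff, hfront, mul_pos_iff_of_pos_left hl,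
      blocked_swap (I.target i).finish (I.target i).start]
    exact (signDetermined_setOf_notMem_blocked _ _ _).mono fun f hf => Or.inl (Or.inl (Or.inr hf))

/-- The locations satisfying the range constraints of target `i`. -/
def inRange : Set Plane :=
  {x | (∀ p ∈ (I.target i).seg, I.Rmin ≤ dist x p) ∧
    dist x (I.target i).start ≤ I.Rmax ∧ dist x (I.target i).finish ≤ I.Rmax}

theorem mem_frustum_iff {x : Plane} {α : ℝ} {p : Plane} :
    p ∈ I.frustum x α ↔
      I.Rmin ≤ dist x p ∧ dist x p ≤ I.Rmax ∧ AngleLE (I.θ / 2) (viewDir α) (p - x) := by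
  rw [AngleLE, norm_viewDir, one_mul, mul_comm, frustum, Set.mem_ofPred_eq]

theorem cos_half_θ_nonneg : 0 ≤ Real.cos (I.θ / 2) :=
  Real.cos_nonneg_of_mem_Icc ⟨by linarith [I.θ_pos, Real.pi_pos], by linarith [I.θ_lt_pi]⟩

theorem seg_subset_frustum_iff (x : Plane) (α : ℝ) :
    (I.target i).seg ⊆ I.frustum x α ↔ x ∈ I.inRange i ∧
      ∀ p ∈ (I.target i).ends, AngleLE (I.θ / 2) (viewDir α) (p - x) := by
  have hs : (I.target i).start ∈ (I.target i).seg := left_mem_segment ℝ _ _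
  have he : (I.target i).finish ∈ (I.target i).seg := right_mem_segment ℝ _ _
  simp only [Set.subset_def, mem_frustum_iff, OLSTarget.ends, Set.forall_mem_insert,
    Set.mem_singleton_iff, forall_eq]
  refine ⟨fun h => ⟨⟨fun p hp => (h p hp).1, (h _ hs).2.1, (h _ he).2.1⟩, (h _ hs).2.2,
    (h _ he).2.2⟩, fun ⟨⟨hmin, hmaxs, hmaxe⟩, hangs, hange⟩ p hp => ⟨hmin p hp, ?_, ?_⟩⟩
  · exact Metric.mem_closedBall'.1 ((convex_closedBall x I.Rmax).segment_subset
      (Metric.mem_closedBall'.2 hmaxs) (Metric.mem_closedBall'.2 hmaxe) hp)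
  · refine (convex_setOf_angleLE I.cos_half_θ_nonneg (viewDir α)).segment_subset hangs hange ?_
    simpa only [neg_add_eq_sub] using (mem_segment_translate ℝ (-x)).2 hp

theorem covers_iff (x : Plane) (α : ℝ) :
    I.Covers x α i ↔ (x ∈ I.frontalView i ∧ x ∈ I.inRange i) ∧
      ∀ p ∈ (I.target i).ends, AngleLE (I.θ / 2) (viewDir α) (p - x) := by
  rw [Covers, seg_subset_frustum_iff, and_comm, and_assoc]

theorem cpf_eq : I.cpf i = I.frontalView i ∩ (I.inRange i ∩
    {x | AngleLE I.θ ((I.target i).start - x) ((I.target i).finish - x)}) := by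
  ext x
  simp only [cpf, covers_iff, exists_and_left, OLSTarget.ends, Set.forall_mem_insert,
    Set.mem_singleton_iff, forall_eq, exists_wedge_pair_iff I.θ_pos.le I.θ_lt_pi, and_assoc,
    Set.mem_inter_iff, Set.mem_ofPred_eq]

theorem signDetermined_inRange_inter_angleLE :
    SignDetermined (I.boundaryFuns i) (I.inRange i ∩
      {x | AngleLE I.θ ((I.target i).start - x) ((I.target i).finish - x)}) := by
  have hmax : ∀ x p : Plane, dist x p ≤ I.Rmax ↔ dist x p ^ 2 - I.Rmax ^ 2 ≤ 0 := fun x p => by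
    rw [sub_nonpos, sq_le_sq₀ dist_nonneg (I.Rmin_nonneg.trans I.Rmin_le_Rmax)]
  have hmin : ∀ x p : Plane, I.Rmin ≤ dist x p ↔ 0 ≤ dist x p ^ 2 - I.Rmin ^ 2 := fun x p => by
    rw [sub_nonneg, sq_le_sq₀ I.Rmin_nonneg dist_nonneg]
  have habs : ∀ a b : ℝ, a ≤ |b| ↔ 0 ≤ b - a ∨ b + a ≤ 0 := fun a b => by
    rw [le_abs, sub_nonneg, ← le_neg_iff_add_nonpos_left]
  intro x y hsign hx
  have hlines : ∀ f ∈ I.rangeLines i, SignType.sign (f x) = SignType.sign (f y) :=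
    fun f hf => hsign f (Or.inl (Or.inr hf))
  have hcircles : ∀ f ∈ I.rangeCircles i, SignType.sign (f x) = SignType.sign (f y) :=
    fun f hf => hsign f (Or.inr hf)
  simp only [rangeLines, rangeCircles, Set.mem_insert_iff, Set.mem_singleton_iff,
    forall_eq_or_imp, forall_eq] at hlines hcircles
  obtain ⟨hside, hstart, hfinish, hleft, hright⟩ := hlines
  obtain ⟨hmaxs, hmaxe, hmins, hmine, haov, haov'⟩ := hcircles
  simp only [inRange, OLSTarget.seg, Set.mem_inter_iff, Set.mem_ofPred_eq,
    forall_mem_segment_le_dist_iff (I.target i).start_ne_finish,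
    angleLE_iff_aovFun_nonneg I.θ_pos I.θ_lt_pi, cross_sub_eq_orient3] at hx ⊢
  simp only [hmin, hmax, habs] at hx ⊢
  rwa [nonneg_iff_of_sign_eq hside, nonpos_iff_of_sign_eq hside, nonneg_iff_of_sign_eq hstart,
    nonneg_iff_of_sign_eq hfinish, nonneg_iff_of_sign_eq hleft, nonpos_iff_of_sign_eq hright,
    nonpos_iff_of_sign_eq hmaxs, nonpos_iff_of_sign_eq hmaxe, nonneg_iff_of_sign_eq hmins,
    nonneg_iff_of_sign_eq hmine, nonneg_iff_of_sign_eq haov, nonneg_iff_of_sign_eq haov'] at hx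

theorem signDeterminedAt_cpf {F : Set (Plane → ℝ)} (hfin : F.Finite)
    (hF : ∀ f ∈ F, IsIsotropicQuadratic f) (hsub : I.boundaryFuns i ⊆ F) {z : Plane}
    {g : Plane → ℝ} (hg : IsRegularAt F z g) : SignDeterminedAt g (I.cpf i) z := by
  have hview := ((I.signDetermined_strictFrontalView i).mono hsub).signDeterminedAt hfin hF hg
  rw [cpf_eq]
  exact (hview.closure hg.changesSignAtZeros).inter
    (((I.signDetermined_inRange_inter_angleLE i).mono hsub).signDeterminedAt hfin hF hg)

theorem eventually_mem_frontier_cpf_iff {F : Set (Plane → ℝ)} (hfin : F.Finite)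
    (hF : ∀ f ∈ F, IsIsotropicQuadratic f) (hsub : I.boundaryFuns i ⊆ F) {z : Plane}
    {g : Plane → ℝ} (hg : IsRegularAt F z g) (hz : z ∈ frontier (I.cpf i)) :
    ∀ᶠ w in 𝓝 z, (w ∈ frontier (I.cpf i) ↔ g w = 0) :=
  (I.signDeterminedAt_cpf i hfin hF hsub hg).eventually_mem_frontier_iff hg.changesSignAtZeros hz

/-! ### Finiteness of the set of candidates -/

/-- Equations of the AOV circles of all pairs of targets. -/
def aovFuns : Set (Plane → ℝ) :=
  {f | ∃ j k, j ≠ k ∧ ∃ p ∈ (I.target j).ends, ∃ q ∈ (I.target k).ends, p ≠ q ∧ f = aovFun I.θ p q}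

theorem finite_aovFuns : I.aovFuns.Finite := by
  have hends : (⋃ j, (I.target j).ends).Finite :=
    Set.finite_iUnion fun j => (Set.finite_singleton _).insert _
  refine (hends.image2 (aovFun I.θ) hends).subset ?_
  rintro f ⟨j, k, -, p, hp, q, hq, -, rfl⟩
  exact Set.mem_image2_of_mem (Set.mem_iUnion_of_mem j hp) (Set.mem_iUnion_of_mem k hq)

theorem isHyperplaneOrSphereEq_of_mem_aovFuns {f : Plane → ℝ} (hf : f ∈ I.aovFuns) :
    IsHyperplaneOrSphereEq f := by
  obtain ⟨j, k, -, p, -, q, -, hpq, rfl⟩ := hf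
  exact isHyperplaneOrSphereEq_aovFun I.sin_θ_pos hpq

theorem mem_aovCircles_iff {C : Set Plane} :
    C ∈ I.aovCircles ↔ ∃ f ∈ I.aovFuns, C = {x | f x = 0} := by
  constructor
  · rintro ⟨j, k, hjk, p, hp, q, hq, hpq, hC⟩
    rw [I.aovCirclesOfChord_eq hpq] at hC
    rcases hC with rfl | rfl
    · exact ⟨_, ⟨j, k, hjk, p, hp, q, hq, hpq, rfl⟩, rfl⟩
    · exact ⟨_, ⟨k, j, hjk.symm, q, hq, p, hp, hpq.symm, rfl⟩, rfl⟩
  · rintro ⟨f, ⟨j, k, hjk, p, hp, q, hq, hpq, rfl⟩, rfl⟩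
    refine ⟨j, k, hjk, p, hp, q, hq, hpq, ?_⟩
    rw [I.aovCirclesOfChord_eq hpq]
    exact Or.inl rfl

/-- Equations of all lines and circles on which candidate locations can lie. -/
def curveFuns : Set (Plane → ℝ) :=
  (⋃ i, I.boundaryFuns i) ∪ I.aovFuns

theorem finite_curveFuns : I.curveFuns.Finite :=
  (Set.finite_iUnion I.finite_boundaryFuns).union I.finite_aovFuns

theorem isIsotropicQuadratic_of_mem_curveFuns {f : Plane → ℝ} (hf : f ∈ I.curveFuns) :
    IsIsotropicQuadratic f := by
  rcases hf with hf | hf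
  · obtain ⟨i, hi⟩ := Set.mem_iUnion.1 hf
    exact I.isIsotropicQuadratic_of_mem_boundaryFuns i hi
  · exact (I.isHyperplaneOrSphereEq_of_mem_aovFuns hf).isIsotropicQuadratic

theorem notMem_candidates_of_isRegularAt {z : Plane} {g : Plane → ℝ}
    (hg : IsRegularAt I.curveFuns z g) : z ∉ I.candidates := by
  have hcurve : ∀ i, z ∈ frontier (I.cpf i) → IsHyperplaneOrSphereEq g ∧ g z = 0 ∧
      ∀ᶠ w in 𝓝 z, (w ∈ frontier (I.cpf i) ↔ g w = 0) := fun i hi => by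
    have hiff := I.eventually_mem_frontier_cpf_iff i I.finite_curveFuns
      (fun _ => I.isIsotropicQuadratic_of_mem_curveFuns)
      (Set.subset_union_of_subset_left (Set.subset_iUnion I.boundaryFuns i) _) hg hi
    have hgz := hiff.self_of_nhds.1 hi
    exact ⟨(hg.isHyperplaneOrSphereEq hgz).2, hgz, hiff⟩
  rintro ((hz | ⟨i, j, -, hz⟩) | ⟨i, C, hC, hz⟩)
  · obtain ⟨i, hi⟩ := Set.mem_iUnion.1 hz
    obtain ⟨hg', -, hiff⟩ := hcurve i (mem_vertices_iff.1 hi).1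
    exact hg'.notMem_vertices hiff hi
  · obtain ⟨⟨hzi, hzj⟩, -⟩ := mem_crossings_iff.1 hz
    obtain ⟨hg', hgz, hiff⟩ := hcurve i hzi
    exact hg'.notMem_crossings hgz hiff (hcurve j hzj).2.2 hz
  · obtain ⟨f, hf, rfl⟩ := I.mem_aovCircles_iff.1 hC
    obtain ⟨⟨hzi, hzf⟩, -⟩ := mem_crossings_iff.1 hz
    obtain ⟨hg', hgz, hiff⟩ := hcurve i hzi
    obtain ⟨l, rfl⟩ := (hg.ne_zero_or_exists_smul f (Or.inr hf)).resolve_left (not_not.2 hzf)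
    have hl : l ≠ 0 := by
      rintro rfl
      obtain ⟨w, hw⟩ := ((I.isHyperplaneOrSphereEq_of_mem_aovFuns hf).frequently_pos hzf).exists
      exact hw.ne' (by simp)
    refine hg'.notMem_crossings hgz hiff (Filter.Eventually.of_forall fun w => ?_) hz
    simp [hl]

theorem finite_candidates : I.candidates.Finite := by
  obtain ⟨Z, hZ, hregular⟩ := exists_finite_forall_notMem_isRegularAt I.finite_curveFuns
    fun _ => I.isIsotropicQuadratic_of_mem_curveFuns
  refine hZ.subset fun z hz => ?_
  by_contra hzZ
  obtain ⟨g, hg⟩ := hregular z hzZ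
  exact I.notMem_candidates_of_isRegularAt hg hz

end OLSC

/-! ### Topology of the regions -/

theorem exists_exit_time {X : Type*} [TopologicalSpace X] {γ : ℝ → X} (hγ : Continuous γ)
    {K : Set X} (hK : IsClosed K) (h0 : γ 0 ∈ K) (hleave : ∃ t, 0 ≤ t ∧ γ t ∉ K) :
    ∃ T, 0 ≤ T ∧ (∀ t ∈ Set.Icc 0 T, γ t ∈ K) ∧ ∃ᶠ t in 𝓝 T, 0 ≤ t ∧ γ t ∉ K := by
  set out := {t | 0 ≤ t ∧ γ t ∉ K}
  have hbdd : BddBelow out := ⟨0, fun t ht => ht.1⟩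
  have hbefore : ∀ t, 0 ≤ t → t < sInf out → γ t ∈ K := fun t ht hlt => by
    by_contra hmem
    exact hlt.not_ge (csInf_le hbdd ⟨ht, hmem⟩)
  refine ⟨sInf out, le_csInf hleave fun t ht => ht.1, fun t ht => ?_,
    mem_closure_iff_frequently.1 (csInf_mem_closure hleave hbdd)⟩
  rcases ht.2.lt_or_eq with hlt | rfl
  · exact hbefore t ht.1 hlt
  rcases ht.1.eq_or_lt with hzero | hpos
  · rwa [← hzero]
  · refine hK.mem_of_tendsto (hγ.continuousWithinAt (s := Set.Iio (sInf out))) ?_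
    filter_upwards [Ioo_mem_nhdsLT hpos] with r hr using hbefore r hr.1.le hr.2

theorem joinedIn_of_forall_mem_Icc {X : Type*} [TopologicalSpace X] {γ : ℝ → X}
    (hγ : Continuous γ) {K : Set X} {T : ℝ} (hT : 0 ≤ T) (h : ∀ t ∈ Set.Icc 0 T, γ t ∈ K) :
    JoinedIn K (γ 0) (γ T) := by
  have himage : IsPathConnected (γ '' Set.Icc 0 T) :=
    ((convex_Icc (0 : ℝ) T).isPathConnected (Set.nonempty_Icc.2 hT)).image hγ
  exact (himage.joinedIn _ (Set.mem_image_of_mem γ (Set.left_mem_Icc.2 hT)) _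
    (Set.mem_image_of_mem γ (Set.right_mem_Icc.2 hT))).mono (Set.image_subset_iff.2 h)

theorem mem_interior_or_mem_frontier_of_isClosed {X : Type*} [TopologicalSpace X] {A : Set X}
    (hA : IsClosed A) {x : X} (hx : x ∈ A) : x ∈ interior A ∨ x ∈ frontier A := by
  rw [hA.frontier_eq]
  exact (em (x ∈ interior A)).imp_right fun hint => ⟨hx, hint⟩

namespace OLSC

variable {n u : ℕ} (I : OLSC n u) (i : Fin n) (S : Finset (Fin n))

theorem isClosed_inRange : IsClosed (I.inRange i) := by
  have hmin : IsClosed {x : Plane | ∀ p ∈ (I.target i).seg, I.Rmin ≤ dist x p} := by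
    simp only [Set.ofPred_forall]
    exact isClosed_biInter fun p _ => isClosed_le continuous_const (by fun_prop)
  have hmax : ∀ p : Plane, IsClosed {x : Plane | dist x p ≤ I.Rmax} := fun p =>
    isClosed_le (by fun_prop) continuous_const
  exact hmin.inter ((hmax _).inter (hmax _))

theorem isClosed_cpf : IsClosed (I.cpf i) := by
  rw [cpf_eq]
  refine isClosed_closure.inter ((I.isClosed_inRange i).inter ?_)
  exact isClosed_le (by fun_prop) (by fun_prop)

variable {i S} {x : Plane}

theorem mem_cpf_iff : x ∈ I.cpf i ↔ (x ∈ I.frontalView i ∧ x ∈ I.inRange i) ∧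
    AngleLE I.θ ((I.target i).start - x) ((I.target i).finish - x) := by
  rw [cpf_eq, ← Set.inter_assoc]
  rfl

theorem isBounded_cpf (i : Fin n) : Bornology.IsBounded (I.cpf i) :=
  Metric.isBounded_closedBall.subset fun _ hx =>
    Metric.mem_closedBall.2 (I.mem_cpf_iff.1 hx).1.2.2.1

theorem front_nonneg_of_mem_cpf (hx : x ∈ I.cpf i) : 0 ≤ (I.target i).front x :=
  closure_minimal (fun y hy => ((I.strictFrontalView_iff i y).1 hy).1.le)
    (isClosed_le continuous_const (I.target i).continuous_front) (I.mem_cpf_iff.1 hx).1.1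

theorem angleLE_of_mem_cpf {p q : Plane} (hp : p ∈ (I.target i).ends) (hq : q ∈ (I.target i).ends)
    (hx : x ∈ I.cpf i) : AngleLE I.θ (p - x) (q - x) := by
  have hangle := (I.mem_cpf_iff.1 hx).2
  rcases hp with rfl | rfl <;> rcases hq with rfl | rfl
  exacts [AngleLE.self, hangle, hangle.symm, AngleLE.self]

/-- The end points of the targets in `S`. -/
def endsOf (S : Finset (Fin n)) : Set Plane :=
  ⋃ i ∈ S, (I.target i).ends

theorem finite_endsOf : (I.endsOf S).Finite :=
  S.finite_toSet.biUnion fun _ _ => (Set.finite_singleton _).insert _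

theorem mem_region_iff : x ∈ I.region S ↔ (∀ i ∈ S, x ∈ I.frontalView i ∧ x ∈ I.inRange i) ∧
    ∃ α, ∀ p ∈ I.endsOf S, AngleLE (I.θ / 2) (viewDir α) (p - x) := by
  simp only [region, covers_iff, forall_and, exists_and_left, endsOf, Set.mem_iUnion₂,
    Set.mem_ofPred_eq, forall_exists_index]
  exact and_congr_right fun _ => exists_congr fun _ => ⟨fun h p i hi => h i hi p,
    fun h i hi p => h p i hi⟩

theorem mem_cpf_of_mem_region (hx : x ∈ I.region S) (hi : i ∈ S) : x ∈ I.cpf i :=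
  hx.imp fun _ h => h i hi

theorem mem_region_of_forall_mem_cpf (h : ∀ i ∈ S, x ∈ I.cpf i)
    (hwedge : ∃ α, ∀ p ∈ I.endsOf S, AngleLE (I.θ / 2) (viewDir α) (p - x)) : x ∈ I.region S :=
  I.mem_region_iff.2 ⟨fun i hi => (I.mem_cpf_iff.1 (h i hi)).1, hwedge⟩

theorem isClosed_region (S : Finset (Fin n)) : IsClosed (I.region S) := by
  have hperiodic : Function.Periodic viewDir (2 * Real.pi) := fun t => by simp [viewDir]
  have hcont : Continuous viewDir :=
    continuous_iff_continuousAt.2 fun t => (hasDerivAt_viewDir t).continuousAt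
  have hregion : I.region S = {x | ∀ i ∈ S, x ∈ I.frontalView i ∧ x ∈ I.inRange i} ∩
      Prod.fst '' {y : Plane × Set.Icc 0 (2 * Real.pi) |
        ∀ p ∈ I.endsOf S, AngleLE (I.θ / 2) (viewDir y.2) (p - y.1)} := by
    ext x
    rw [mem_region_iff]
    refine and_congr_right fun _ => ⟨?_, ?_⟩
    · rintro ⟨α, hα⟩
      obtain ⟨β, hβ, hαβ⟩ := hperiodic.exists_mem_Ico₀ Real.two_pi_pos α
      rw [hαβ] at hα
      exact ⟨(x, ⟨β, hβ.1, hβ.2.le⟩), hα, rfl⟩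
    · rintro ⟨⟨x', α⟩, h, rfl⟩
      exact ⟨α, h⟩
  rw [hregion]
  refine IsClosed.inter ?_ (isClosedMap_fst_of_compactSpace _ ?_) <;>
    simp only [Set.ofPred_forall]
  · exact isClosed_biInter fun i _ => isClosed_closure.inter (I.isClosed_inRange i)
  · exact isClosed_biInter fun p _ => isClosed_le (by fun_prop) (by fun_prop)

end OLSC

/-! ### End points of a target are vertices of its camera placement field -/

theorem angleLE_neg_of_hasDerivAt {V : Type*} [NormedAddCommGroup V] [InnerProductSpace ℝ V] {θ : ℝ}
    {γ : ℝ → V} {τ q : V} (hγ : HasDerivAt γ τ 0)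
    (h : ∀ᶠ t in 𝓝[>] 0, AngleLE θ (γ 0 - γ t) (q - γ t)) : AngleLE θ (-τ) (q - γ 0) := by
  have hslope : Filter.Tendsto (fun t : ℝ => t⁻¹ • (γ 0 - γ t)) (𝓝[>] 0) (𝓝 (-τ)) := by
    have hlim := (hasDerivAt_iff_tendsto_slope_zero.1 hγ).neg.mono_left
      (nhdsWithin_mono (0 : ℝ) fun t (ht : t ∈ Set.Ioi 0) => ne_of_gt ht)
    simpa only [zero_add, ← smul_neg, neg_sub] using hlim
  have hsub : Filter.Tendsto (fun t => q - γ t) (𝓝[>] 0) (𝓝 (q - γ 0)) :=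
    (hγ.continuousAt.tendsto.mono_left nhdsWithin_le_nhds).const_sub q
  refine le_of_tendsto_of_tendsto (tendsto_const_nhds.mul (hslope.norm.mul hsub.norm))
    (hslope.inner hsub) ?_
  filter_upwards [h, self_mem_nhdsWithin] with t ht (hpos : 0 < t)
  exact (ht.symm.smul_right (inv_nonneg.2 hpos.le)).symm

theorem angleLE_of_hasDerivAt {V : Type*} [NormedAddCommGroup V] [InnerProductSpace ℝ V] {θ : ℝ}
    {γ : ℝ → V} {τ q : V} (hγ : HasDerivAt γ τ 0)
    (h : ∀ᶠ t in 𝓝[<] 0, AngleLE θ (γ 0 - γ t) (q - γ t)) : AngleLE θ τ (q - γ 0) := by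
  have hrev : HasDerivAt (fun t => γ (-t)) (-τ) 0 := by
    simpa [Function.comp_def] using
      HasDerivAt.scomp (0 : ℝ) (g₁ := γ) (by simpa using hγ) (hasDerivAt_neg 0)
  have hneg : Filter.Tendsto (fun t : ℝ => -t) (𝓝[>] 0) (𝓝[<] 0) := by
    simpa using tendsto_neg_nhdsGT (a := (0 : ℝ))
  simpa using angleLE_neg_of_hasDerivAt (q := q) hrev (by simpa using hneg.eventually h)

theorem Plane.abs_inner_eq_of_inner_eq_zero {u v w : Plane} (hw : w ≠ 0) (hu : inner ℝ w u = 0)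
    (hv : inner ℝ w v = 0) : |inner ℝ u v| = ‖u‖ * ‖v‖ := by
  obtain ⟨a, rfl⟩ := exists_eq_smul_rot_of_inner_eq_zero hw hu
  obtain ⟨b, rfl⟩ := exists_eq_smul_rot_of_inner_eq_zero hw hv
  rw [real_inner_smul_left, real_inner_smul_right, real_inner_self_eq_norm_mul_norm, abs_mul,
    abs_mul, abs_mul_self, norm_smul, norm_smul, Real.norm_eq_abs, Real.norm_eq_abs]
  ring

namespace OLSTarget

variable {T : OLSTarget} {p q : Plane}

theorem front_eq_zero_of_mem_ends (hp : p ∈ T.ends) : T.front p = 0 := by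
  rcases hp with rfl | rfl
  exacts [T.front_start, T.front_finish]

theorem exists_ne_mem_ends (T : OLSTarget) (p : Plane) : ∃ q ∈ T.ends, q ≠ p := by
  by_contra! h
  exact T.start_ne_finish ((h _ (Or.inl rfl)).trans (h _ (Or.inr rfl)).symm)

end OLSTarget

namespace OLSC

variable {n u : ℕ} (I : OLSC n u) {i : Fin n} {p : Plane}

theorem notMem_interior_cpf_of_front_eq_zero (hp : (I.target i).front p = 0) :
    p ∉ interior (I.cpf i) := by
  intro hint
  set step : ℝ → Plane := fun t => p - t • (I.target i).orient
  have hstep : Filter.Tendsto step (𝓝[>] 0) (𝓝 p) := by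
    have hcont : Continuous step := by fun_prop
    simpa [step] using (hcont.tendsto 0).mono_left nhdsWithin_le_nhds
  obtain ⟨t, ht, hpos : 0 < t⟩ := ((hstep.eventually_mem (mem_interior_iff_mem_nhds.1 hint)).and
    self_mem_nhdsWithin).exists
  have hfront : (I.target i).front (step t) = -(t * ‖(I.target i).orient‖ ^ 2) := by
    rw [← sub_zero ((I.target i).front (step t)), ← hp, OLSTarget.front_sub, sub_sub_cancel_left,
      inner_neg_right, real_inner_smul_right, real_inner_self_eq_norm_sq]
  have hsq := pow_pos (norm_pos_iff.2 (I.target i).orient_ne_zero) 2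
  linarith [I.front_nonneg_of_mem_cpf ht, mul_pos hpos hsq]

theorem mem_frontier_cpf_of_mem_ends (hp : p ∈ (I.target i).ends) (hpc : p ∈ I.cpf i) :
    p ∈ frontier (I.cpf i) :=
  (mem_interior_or_mem_frontier_of_isClosed (I.isClosed_cpf i) hpc).resolve_left
    (I.notMem_interior_cpf_of_front_eq_zero (OLSTarget.front_eq_zero_of_mem_ends hp))

/-- At an end point `p` the camera placement field lies in front of the target, so a smooth boundary
curve through `p` is tangent to the target there; moving along it away from the target, the angle of
view at which the target is seen tends to `π`. -/
theorem not_eventually_mem_cpf_of_hasDerivAt {γ : ℝ → Plane} {τ : Plane}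
    (hp : γ 0 ∈ (I.target i).ends) (hγ : HasDerivAt γ τ 0) (hτ : τ ≠ 0) :
    ¬ ∀ᶠ t in 𝓝 0, γ t ∈ I.cpf i := by
  intro hmem
  obtain ⟨q, hq, hqp⟩ := (I.target i).exists_ne_mem_ends (γ 0)
  have hfront0 := OLSTarget.front_eq_zero_of_mem_ends hp
  have hτ_perp : inner ℝ (I.target i).orient τ = 0 := by
    have hderiv : HasDerivAt (fun t => (I.target i).front (γ t))
        (inner ℝ (I.target i).orient τ) 0 := by
      simpa [OLSTarget.front] using (hasDerivAt_const (0 : ℝ) (I.target i).orient).inner ℝ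
        (hγ.sub_const (midpoint ℝ (I.target i).start (I.target i).finish))
    refine IsLocalMin.hasDerivAt_eq_zero ?_ hderiv
    filter_upwards [hmem] with t ht
    exact hfront0.trans_le (I.front_nonneg_of_mem_cpf ht)
  have hq_perp : inner ℝ (I.target i).orient (q - γ 0) = 0 := by
    rw [← OLSTarget.front_sub, hfront0, OLSTarget.front_eq_zero_of_mem_ends hq, sub_zero]
  have hparallel := Plane.abs_inner_eq_of_inner_eq_zero (I.target i).orient_ne_zero hτ_perp hq_perp
  have hforward : AngleLE I.θ (-τ) (q - γ 0) := angleLE_neg_of_hasDerivAt hγ <| by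
    filter_upwards [hmem.filter_mono nhdsWithin_le_nhds] with t ht
    exact I.angleLE_of_mem_cpf hp hq ht
  have hbackward : AngleLE I.θ τ (q - γ 0) := angleLE_of_hasDerivAt hγ <| by
    filter_upwards [hmem.filter_mono nhdsWithin_le_nhds] with t ht
    exact I.angleLE_of_mem_cpf hp hq ht
  rw [AngleLE, norm_neg, inner_neg_left] at hforward
  rw [AngleLE] at hbackward
  have hcos : -1 < Real.cos I.θ := by
    simpa using Real.cos_lt_cos_of_nonneg_of_le_pi I.θ_pos.le le_rfl I.θ_lt_pi
  have hpos : 0 < ‖τ‖ * ‖q - γ 0‖ :=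
    mul_pos (norm_pos_iff.2 hτ) (norm_pos_iff.2 (sub_ne_zero.2 hqp))
  rcases abs_cases (inner ℝ τ (q - γ 0) : ℝ) with ⟨h, -⟩ | ⟨h, -⟩ <;> nlinarith

theorem mem_vertices_of_mem_ends (hp : p ∈ (I.target i).ends) (hpc : p ∈ I.cpf i) :
    p ∈ vertices (I.cpf i) := by
  have hpf := I.mem_frontier_cpf_of_mem_ends hp hpc
  refine mem_vertices_iff.2 ⟨hpf, ?_⟩
  rintro ⟨g, hg, hiff⟩
  obtain ⟨γ, γ', rfl, hzero, hderiv, -⟩ := hg.exists_param (hiff.self_of_nhds.1 hpf)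
  refine I.not_eventually_mem_cpf_of_hasDerivAt hp (hderiv 0).1 (hderiv 0).2 ?_
  filter_upwards [(hderiv 0).1.continuousAt.eventually hiff] with t ht
  exact (I.isClosed_cpf i).frontier_subset (ht.2 (hzero t))

end OLSC

/-! ### Moving a camera to a candidate location -/

namespace OLSC

variable {n u : ℕ} (I : OLSC n u) {S : Finset (Fin n)} {i : Fin n} {z : Plane} {g : Plane → ℝ}

theorem exists_curve_of_notMem_candidates (hz : z ∈ frontier (I.cpf i)) (hcand : z ∉ I.candidates) :
    ∃ g, IsHyperplaneOrSphereEq g ∧ ∀ᶠ w in 𝓝 z, (w ∈ frontier (I.cpf i) ↔ g w = 0) := by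
  by_contra hno
  exact hcand (Or.inl (Or.inl (Set.mem_iUnion.2 ⟨i, mem_vertices_iff.2 ⟨hz, hno⟩⟩)))

theorem notMem_endsOf_of_notMem_candidates (hz : z ∈ I.region S) (hcand : z ∉ I.candidates) :
    z ∉ I.endsOf S := by
  intro hend
  obtain ⟨j, hj, hzj⟩ := Set.mem_iUnion₂.1 hend
  exact hcand (Or.inl (Or.inl (Set.mem_iUnion.2
    ⟨j, I.mem_vertices_of_mem_ends hzj (I.mem_cpf_of_mem_region hz hj)⟩)))

theorem eventually_mem_cpf_of_eq_zero (hg : IsHyperplaneOrSphereEq g)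
    (hz : z ∈ frontier (I.cpf i)) (hiff : ∀ᶠ w in 𝓝 z, (w ∈ frontier (I.cpf i) ↔ g w = 0))
    (hcand : z ∉ I.candidates) {j : Fin n} (hzj : z ∈ I.cpf j) :
    ∀ᶠ w in 𝓝 z, g w = 0 → w ∈ I.cpf j := by
  have hclosed := (I.isClosed_cpf j).frontier_subset
  by_cases hij : i = j
  · subst hij
    exact hiff.mono fun w hw hgw => hclosed (hw.2 hgw)
  rcases mem_interior_or_mem_frontier_of_isClosed (I.isClosed_cpf j) hzj with hint | hzf
  · filter_upwards [mem_interior_iff_mem_nhds.1 hint] with w hw _ using hw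
  obtain ⟨g', hg', hiff'⟩ := I.exists_curve_of_notMem_candidates hzf hcand
  obtain ⟨l, -, rfl⟩ := hg.exists_smul_eq_of_notMem_crossings hg' ⟨hz, hzf⟩ hiff hiff'
    fun hcross => hcand (Or.inl (Or.inr ⟨i, j, hij, hcross⟩))
  exact hiff'.mono fun w hw hgw => hclosed (hw.2 (by simp [hgw]))

theorem exists_smul_eq_of_mem_aovFuns (hg : IsHyperplaneOrSphereEq g)
    (hz : z ∈ frontier (I.cpf i)) (hiff : ∀ᶠ w in 𝓝 z, (w ∈ frontier (I.cpf i) ↔ g w = 0))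
    (hcand : z ∉ I.candidates) {f : Plane → ℝ} (hf : f ∈ I.aovFuns) (hfz : f z = 0) :
    ∃ l : ℝ, l ≠ 0 ∧ f = l • g :=
  hg.exists_smul_eq_of_notMem_crossings (B := {x | f x = 0})
    (I.isHyperplaneOrSphereEq_of_mem_aovFuns hf) ⟨hz, hfz⟩ hiff (.of_forall fun _ => Iff.rfl)
    fun hcross => hcand (Or.inr ⟨i, _, I.mem_aovCircles_iff.2 ⟨f, hf, rfl⟩, hcross⟩)

theorem eventually_angleLE_of_eq_zero (hg : IsHyperplaneOrSphereEq g)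
    (hz : z ∈ frontier (I.cpf i)) (hiff : ∀ᶠ w in 𝓝 z, (w ∈ frontier (I.cpf i) ↔ g w = 0))
    (hcand : z ∉ I.candidates) {j k : Fin n} (hzj : z ∈ I.cpf j) {p q : Plane}
    (hp : p ∈ (I.target j).ends) (hq : q ∈ (I.target k).ends) (hpz : p ≠ z) (hqz : q ≠ z)
    (hangle : AngleLE I.θ (p - z) (q - z)) :
    ∀ᶠ w in 𝓝 z, g w = 0 → AngleLE I.θ (p - w) (q - w) := by
  by_cases hpq : p = q
  · exact .of_forall fun w _ => hpq ▸ AngleLE.self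
  by_cases hjk : j = k
  · subst hjk
    exact (I.eventually_mem_cpf_of_eq_zero hg hz hiff hcand hzj).mono fun w hw hgw =>
      I.angleLE_of_mem_cpf hp hq (hw hgw)
  have haov : ∀ f ∈ I.aovFuns, f z = 0 →
      (∀ᶠ w in 𝓝 z, f w = 0 → AngleLE I.θ (p - w) (q - w)) →
      ∀ᶠ w in 𝓝 z, g w = 0 → AngleLE I.θ (p - w) (q - w) := fun f hf hfz hev => by
    obtain ⟨l, -, rfl⟩ := I.exists_smul_eq_of_mem_aovFuns hg hz hiff hcand hf hfz
    exact hev.mono fun w hw hgw => hw (by simp [hgw])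
  rcases hangle.eventually_or_aovFun_eq_zero I.θ_pos I.θ_lt_pi hpz hqz with
    hev | ⟨hzero, hev⟩ | ⟨hzero, hev⟩
  · exact hev.mono fun w hw _ => hw
  · exact haov _ ⟨j, k, hjk, p, hp, q, hq, hpq, rfl⟩ hzero hev
  · exact haov _ ⟨k, j, Ne.symm hjk, q, hq, p, hp, Ne.symm hpq, rfl⟩ hzero hev

theorem eventually_mem_region_of_eq_zero (hg : IsHyperplaneOrSphereEq g)
    (hz : z ∈ frontier (I.cpf i)) (hiff : ∀ᶠ w in 𝓝 z, (w ∈ frontier (I.cpf i) ↔ g w = 0))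
    (hcand : z ∉ I.candidates) (hregion : z ∈ I.region S) :
    ∀ᶠ w in 𝓝 z, g w = 0 → w ∈ I.region S := by
  have hends := I.notMem_endsOf_of_notMem_candidates hregion hcand
  obtain ⟨-, α, hα⟩ := I.mem_region_iff.1 hregion
  have hcpf : ∀ᶠ w in 𝓝 z, ∀ j ∈ S, g w = 0 → w ∈ I.cpf j :=
    (Finset.eventually_all S).2 fun j hj =>
      I.eventually_mem_cpf_of_eq_zero hg hz hiff hcand (I.mem_cpf_of_mem_region hregion hj)
  have hangle : ∀ᶠ w in 𝓝 z, ∀ p ∈ I.endsOf S, ∀ q ∈ I.endsOf S,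
      g w = 0 → AngleLE I.θ (p - w) (q - w) := by
    refine (Filter.eventually_all_finite I.finite_endsOf).2 fun p hp =>
      (Filter.eventually_all_finite I.finite_endsOf).2 fun q hq => ?_
    obtain ⟨j, hj, hpj⟩ := Set.mem_iUnion₂.1 hp
    obtain ⟨k, -, hqk⟩ := Set.mem_iUnion₂.1 hq
    have hpq := (hα p hp).symm.trans (hα q hq) (viewDir_ne_zero α) (half_pos I.θ_pos).le
      (half_pos I.θ_pos).le (by linarith [I.θ_lt_pi])
    rw [add_halves] at hpq
    exact I.eventually_angleLE_of_eq_zero hg hz hiff hcand (I.mem_cpf_of_mem_region hregion hj)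
      hpj hqk (ne_of_mem_of_not_mem hp hends) (ne_of_mem_of_not_mem hq hends) hpq
  filter_upwards [hcpf, hangle, eventually_exists_wedge I.θ_pos.le I.θ_lt_pi I.finite_endsOf hends
    hα] with w hw hangle_w hwedge hgw
  exact I.mem_region_of_forall_mem_cpf (fun j hj => hw j hj hgw)
    (hwedge fun p hp q hq => hangle_w p hp q hq hgw)

theorem eventually_mem_region_inter_frontier (hg : IsHyperplaneOrSphereEq g)
    (hz : z ∈ I.region S ∩ frontier (I.cpf i)) (hcand : z ∉ I.candidates)
    (hfreq : ∃ᶠ w in 𝓝[≠] z, g w = 0 ∧ w ∈ frontier (I.cpf i)) :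
    ∀ᶠ w in 𝓝 z, g w = 0 → w ∈ I.region S ∩ frontier (I.cpf i) := by
  obtain ⟨g', hg', hiff⟩ := I.exists_curve_of_notMem_candidates hz.2 hcand
  obtain ⟨l, -, rfl⟩ := hg.exists_smul_eq_of_frequently hg' ((hfreq.and_eventually
    (hiff.filter_mono nhdsWithin_le_nhds)).mono fun w ⟨⟨hgw, hw⟩, hwiff⟩ => ⟨hgw, hwiff.1 hw⟩)
  have hregion := I.eventually_mem_region_of_eq_zero hg' hz.2 hiff hcand hz.1
  filter_upwards [hiff, hregion] with w hw hw' hgw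
  have hgw' : (l • g) w = 0 := by simp [hgw]
  exact ⟨hw' hgw', hw.2 hgw'⟩

theorem not_forall_mem_frontier_cpf_of_eq_zero (hg : IsHyperplaneOrSphereEq g) (hz : g z = 0) :
    ¬ ∀ x, g x = 0 → x ∈ frontier (I.cpf i) := by
  intro hall
  have hmem : ∀ x, g x = 0 → x ∈ I.cpf i := fun x hx =>
    (I.isClosed_cpf i).frontier_subset (hall x hx)
  have hinf : {x | g x = 0}.Infinite :=
    .of_accPt (accPt_iff_frequently_nhdsNE.2 (hg.frequently_eq_zero hz))
  have hF : ∀ f ∈ I.boundaryFuns i, IsIsotropicQuadratic f :=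
    fun _ => I.isIsotropicQuadratic_of_mem_boundaryFuns i
  obtain ⟨Z, hZ, hregular⟩ := exists_finite_forall_notMem_isRegularAt (I.finite_boundaryFuns i) hF
  obtain ⟨w, hw, hwZ⟩ := hinf.exists_notMem_finite hZ
  obtain ⟨f, hf⟩ := hregular w hwZ
  have hiff := I.eventually_mem_frontier_cpf_iff i (I.finite_boundaryFuns i) hF subset_rfl hf
    (hall w hw)
  obtain ⟨hf_mem, hf_curve⟩ := hf.isHyperplaneOrSphereEq (hiff.self_of_nhds.1 (hall w hw))
  obtain ⟨l, hl, rfl⟩ := hg.exists_smul_eq_of_frequently hf_curve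
    (((hg.frequently_eq_zero hw).and_eventually (hiff.filter_mono nhdsWithin_le_nhds)).mono
      fun x ⟨hx, hxiff⟩ => ⟨hx, hxiff.1 (hall x hx)⟩)
  have hzeros : {x | (l • g) x = 0} = {x | g x = 0} := by simp [hl]
  obtain ⟨x, hx, hneg⟩ := I.exists_front_neg_of_isBounded i hf_mem
    (hzeros ▸ (I.isBounded_cpf i).subset hmem) (hzeros ▸ hinf.nontrivial)
  exact hneg.not_ge (I.front_nonneg_of_mem_cpf (hmem x (hzeros.subset hx)))

/-- Follow the boundary of the camera placement field. Without a candidate on the way, the path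
never leaves the boundary arc, which therefore closes up to a full line or circle. -/
theorem exists_candidate_of_mem_frontier (hz : z ∈ I.region S) (hzf : z ∈ frontier (I.cpf i)) :
    ∃ p ∈ I.candidates, p ∈ I.region S ∧ JoinedIn (I.region S) z p := by
  by_contra! hno
  have hcand : z ∉ I.candidates := fun h => hno z h hz (JoinedIn.refl hz)
  obtain ⟨g, hg, hiff⟩ := I.exists_curve_of_notMem_candidates hzf hcand
  have hgz := hiff.self_of_nhds.1 hzf
  obtain ⟨γ, γ', rfl, hzero, hderiv, hfull⟩ := hg.exists_param hgz
  have hγ : Continuous γ := continuous_iff_continuousAt.2 fun t => (hderiv t).1.continuousAt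
  have hstay : ∀ t, 0 ≤ t → γ t ∈ I.region S ∩ frontier (I.cpf i) := by
    by_contra! hleave
    obtain ⟨T, hT, hin, hout⟩ :=
      exists_exit_time hγ ((I.isClosed_region S).inter isClosed_frontier) ⟨hz, hzf⟩ hleave
    have hTcand : γ T ∉ I.candidates := fun h => hno _ h (hin T ⟨hT, le_rfl⟩).1
      (joinedIn_of_forall_mem_Icc hγ hT fun t ht => (hin t ht).1)
    have hfreq : ∃ᶠ t in 𝓝[≠] T, γ t ∈ frontier (I.cpf i) := by
      rcases hT.eq_or_lt with rfl | hpos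
      · exact (((hγ.tendsto 0).eventually hiff).mono fun t ht => ht.2 (hzero t)).filter_mono
          nhdsWithin_le_nhds |>.frequently
      · refine (Filter.Eventually.frequently (f := 𝓝[<] T) ?_).filter_mono
          (nhdsWithin_mono T fun t ht => ne_of_lt ht)
        filter_upwards [Ioo_mem_nhdsLT hpos] with t ht using (hin t ⟨ht.1.le, ht.2.le⟩).2
    have hnear := I.eventually_mem_region_inter_frontier hg (hin T ⟨hT, le_rfl⟩) hTcand
      (((hderiv T).1.tendsto_nhdsNE (hderiv T).2).frequently
        (hfreq.mono fun t ht => ⟨hzero t, ht⟩))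
    obtain ⟨t, ⟨-, ht⟩, ht'⟩ := (hout.and_eventually ((hγ.tendsto T).eventually hnear)).exists
    exact ht (ht' (hzero t))
  rcases hfull with hunbounded | hsurj
  · obtain ⟨M, hM⟩ := (I.isBounded_cpf i).exists_norm_le
    obtain ⟨t, ht, hnorm⟩ := hunbounded M
    exact hnorm.not_ge (hM _ ((I.isClosed_cpf i).frontier_subset (hstay t ht).2))
  · refine I.not_forall_mem_frontier_cpf_of_eq_zero (i := i) hg hgz fun x hx => ?_
    obtain ⟨t, ht, rfl⟩ := hsurj x hx
    exact (hstay t ht).2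

/-- Move the camera backwards along its viewing direction. -/
theorem exists_joinedIn_frontier_cpf (hS : S.Nonempty) (hz : z ∈ I.region S) :
    ∃ y ∈ I.region S, (∃ i, y ∈ frontier (I.cpf i)) ∧ JoinedIn (I.region S) z y := by
  obtain ⟨-, α, hα⟩ := I.mem_region_iff.1 hz
  set β : ℝ → Plane := fun t => z - t • viewDir α with hβ_def
  have hβ : Continuous β := by fun_prop
  have hβ0 : β 0 = z := by simp [hβ_def]
  have hregion : ∀ t, 0 ≤ t → (∀ i ∈ S, β t ∈ I.cpf i) → β t ∈ I.region S := fun t ht hcpf => by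
    refine I.mem_region_of_forall_mem_cpf hcpf ⟨α, fun p hp => ?_⟩
    have hshift : p - β t = p - z + t • viewDir α := by simp only [hβ_def]; module
    rw [hshift]
    exact (hα p hp).add_right I.cos_half_θ_nonneg (AngleLE.self.smul_right ht)
  have hleave : ∃ t, 0 ≤ t ∧ β t ∉ I.region S := by
    obtain ⟨i, hi⟩ := hS
    obtain ⟨r, hr⟩ := (I.isBounded_cpf i).subset_closedBall z
    refine ⟨max r 0 + 1, by positivity, fun hmem => ?_⟩
    have hdist := Metric.mem_closedBall.1 (hr (I.mem_cpf_of_mem_region hmem hi))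
    rw [hβ_def, dist_eq_norm, sub_sub_cancel_left, norm_neg, norm_smul, norm_viewDir, mul_one,
      Real.norm_of_nonneg (by positivity)] at hdist
    linarith [le_max_left r 0]
  obtain ⟨T, hT, hin, hout⟩ :=
    exists_exit_time hβ (I.isClosed_region S) (hβ0.symm ▸ hz) hleave
  have hTmem := hin T ⟨hT, le_rfl⟩
  refine ⟨β T, hTmem, ?_, hβ0 ▸ joinedIn_of_forall_mem_Icc hβ hT hin⟩
  by_contra! hno
  have hcpf : ∀ᶠ t in 𝓝 T, ∀ i ∈ S, β t ∈ I.cpf i := (Finset.eventually_all S).2 fun i hi =>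
    (hβ.tendsto T).eventually_mem (mem_interior_iff_mem_nhds.1
      ((mem_interior_or_mem_frontier_of_isClosed (I.isClosed_cpf i)
        (I.mem_cpf_of_mem_region hTmem hi)).resolve_right (hno i)))
  obtain ⟨t, ⟨ht, hnot⟩, hall⟩ := (hout.and_eventually hcpf).exists
  exact hnot (hregion t ht hall)

theorem exists_candidate_joinedIn (hS : S.Nonempty) (hz : z ∈ I.region S) :
    ∃ p ∈ I.candidates, p ∈ I.region S ∧ JoinedIn (I.region S) z p := by
  obtain ⟨y, hy, ⟨i, hyi⟩, hzy⟩ := I.exists_joinedIn_frontier_cpf hS hz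
  obtain ⟨p, hp, hpS, hyp⟩ := I.exists_candidate_of_mem_frontier hy hyi
  exact ⟨p, hp, hpS, hzy.trans hyp⟩

end OLSC

/-! ### Greedy set cover -/

namespace GreedyRun

variable {ι : Type} [DecidableEq ι] {R : Set (Finset ι)} {U : Finset ι}

theorem exists_of_forall_exists_mem [Finite ι] (hR : ∀ i, ∃ C ∈ R, i ∈ C) (U : Finset ι) :
    ∃ l, GreedyRun R U l := by
  induction U using Finset.strongInduction with
  | H U ih =>
    rcases U.eq_empty_or_nonempty with rfl | ⟨i, hi⟩
    · exact ⟨[], .done⟩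
    obtain ⟨D, hD, hiD⟩ := hR i
    obtain ⟨C, hC, hmax⟩ :=
      Set.exists_max_image R (fun C => (C ∩ U).card) (Set.toFinite R) ⟨D, hD⟩
    have hpos : 0 < (C ∩ U).card :=
      (Finset.card_pos.2 ⟨i, Finset.mem_inter.2 ⟨hiD, hi⟩⟩).trans_le (hmax D hD)
    obtain ⟨l, hl⟩ := ih (U \ C) (sdiff_lt_left.2
      (Finset.not_disjoint_iff_nonempty_inter.2 (Finset.card_pos.1 hpos)))
    exact ⟨C :: l, .pick U C l ⟨i, hi⟩ hC hmax hl⟩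

theorem eq_nil_of_empty {l : List (Finset ι)} (h : GreedyRun R ∅ l) : l = [] := by
  cases h with
  | done => rfl
  | pick _ _ _ hU => exact absurd hU Finset.not_nonempty_empty

theorem card_le_mul_card_inter {k : ℕ} {D : Fin k → Finset ι} {C : Finset ι}
    (hD : ∀ i ∈ U, ∃ m, D m ∈ R ∧ i ∈ D m) (hmax : ∀ C' ∈ R, (C' ∩ U).card ≤ (C ∩ U).card) :
    U.card ≤ k * (C ∩ U).card := by
  classical
  set s : Finset (Fin k) := {m | D m ∈ R}
  have hsub : U ⊆ s.biUnion fun m => D m ∩ U := fun i hi => by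
    obtain ⟨m, hm, him⟩ := hD i hi
    exact Finset.mem_biUnion.2 ⟨m, by simpa [s] using hm, Finset.mem_inter.2 ⟨him, hi⟩⟩
  calc U.card ≤ (s.biUnion fun m => D m ∩ U).card := Finset.card_le_card hsub
    _ ≤ s.card * (C ∩ U).card :=
      Finset.card_biUnion_le_card_mul _ _ _ fun m hm => hmax _ (Finset.mem_filter.1 hm).2
    _ ≤ k * (C ∩ U).card := Nat.mul_le_mul_right _ (by simpa using s.card_le_univ)

end GreedyRun

theorem log_le_log_sub_inv {u v c k : ℝ} (hv : 0 < v) (hu : 0 < u) (hk : 0 < k)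
    (huv : v + c = u) (huc : u ≤ k * c) : Real.log v ≤ Real.log u - k⁻¹ := by
  have hratio : v / u ≤ 1 - k⁻¹ := by
    rw [div_le_iff₀ hu, sub_mul, one_mul, inv_mul_eq_div]
    linarith [(div_le_iff₀' hk).2 huc]
  have hlog := Real.log_le_sub_one_of_pos (div_pos hv hu)
  rw [Real.log_div hv.ne' hu.ne'] at hlog
  linarith

theorem GreedyRun.length_le {ι : Type} [DecidableEq ι] {R : Set (Finset ι)} {k : ℕ}
    {D : Fin k → Finset ι} {U : Finset ι} {l : List (Finset ι)} (h : GreedyRun R U l)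
    (hD : ∀ i ∈ U, ∃ m, D m ∈ R ∧ i ∈ D m) :
    (l.length : ℝ) ≤ (1 + Real.log U.card) * k := by
  induction h with
  | done => simp
  | pick U C l hU _ hmax hl ih =>
    have hk : (1 : ℝ) ≤ k := by
      obtain ⟨i, hi⟩ := hU
      obtain ⟨m, -⟩ := hD i hi
      exact_mod_cast Fin.pos m
    have hcard : (U.card : ℝ) ≤ k * (C ∩ U).card := mod_cast card_le_mul_card_inter hD hmax
    have hsplit : ((U \ C).card : ℝ) + (C ∩ U).card = U.card := by
      rw [Finset.inter_comm]
      exact_mod_cast Finset.card_sdiff_add_card_inter U C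
    rw [List.length_cons, Nat.cast_succ]
    rcases (U \ C).eq_empty_or_nonempty with hempty | hne
    · obtain rfl := eq_nil_of_empty (hempty ▸ hl)
      have hlog := Real.log_natCast_nonneg U.card
      simp only [List.length_nil, Nat.cast_zero, zero_add]
      nlinarith
    · have hlog := log_le_log_sub_inv (mod_cast hne.card_pos) (mod_cast hU.card_pos)
        (by linarith) hsplit hcard
      calc (l.length : ℝ) + 1 ≤ (1 + Real.log (U \ C).card) * k + 1 := by
            linarith [ih fun i hi => hD i (Finset.mem_sdiff.1 hi).1]
        _ ≤ (1 + (Real.log U.card - (k : ℝ)⁻¹)) * k + 1 := by gcongr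
        _ = (1 + Real.log U.card) * k := by field_simp; ring

namespace OLSC

variable {n u : ℕ} (I : OLSC n u)

theorem exists_configuration_of_cov_nonempty {x : Plane} {α : ℝ} (hne : (I.cov x α).Nonempty) :
    ∃ C ∈ I.configurations, I.cov x α ⊆ C := by
  classical
  have hx : x ∈ I.region (I.cov x α) := ⟨α, fun i hi => (Finset.mem_filter.1 hi).2⟩
  obtain ⟨p, hp, ⟨β, hβ⟩, -⟩ := I.exists_candidate_joinedIn hne hx
  obtain ⟨C, hC, hmax⟩ := Set.Finite.exists_le_maximal
    (s := {D | ∃ α : ℝ, D = I.cov p α}) (Set.toFinite _) ⟨β, rfl⟩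
  exact ⟨C, ⟨p, hp, hmax⟩,
    fun i hi => hC (Finset.mem_filter.2 ⟨Finset.mem_univ i, hβ i hi⟩)⟩

theorem exists_configurations_of_covers {k : ℕ} {c : Fin k → Plane × ℝ}
    (hc : ∀ i, ∃ m, I.Covers (c m).1 (c m).2 i) :
    ∃ D : Fin k → Finset (Fin n), ∀ i, ∃ m, D m ∈ I.configurations ∧ i ∈ D m := by
  classical
  choose! C hC hsub using fun m => I.exists_configuration_of_cov_nonempty
    (x := (c m).1) (α := (c m).2)
  refine ⟨C, fun i => ?_⟩
  obtain ⟨m, hm⟩ := hc i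
  have hi : i ∈ I.cov (c m).1 (c m).2 := Finset.mem_filter.2 ⟨Finset.mem_univ i, hm⟩
  exact ⟨m, hC m ⟨i, hi⟩, hsub m ⟨i, hi⟩ hi⟩

end OLSC

theorem mainTheorem5 {n u : ℕ} (I : OLSC n u) :
    I.candidates.Finite ∧
    (∀ S : Finset (Fin n), S.Nonempty → ∀ x ∈ I.region S,
      ∃ p ∈ I.candidates, p ∈ I.region S ∧ JoinedIn (I.region S) x p) ∧
    (∀ (k : ℕ) (c : Fin k → Plane × ℝ), (∀ i, ∃ m, I.Covers (c m).1 (c m).2 i) →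
      (∀ U : Finset (Fin n), ∃ l, GreedyRun I.configurations U l) ∧
      ∀ l, GreedyRun I.configurations Finset.univ l →
        (l.length : ℝ) ≤ (1 + Real.log n) * k) := by
  refine ⟨I.finite_candidates, fun S hS x hx => I.exists_candidate_joinedIn hS hx,
    fun k c hc => ?_⟩
  obtain ⟨D, hD⟩ := I.exists_configurations_of_covers hc
  refine ⟨GreedyRun.exists_of_forall_exists_mem fun i => ?_, fun l hl => ?_⟩
  · obtain ⟨m, hm, hi⟩ := hD i
    exact ⟨D m, hm, hi⟩
  · simpa using hl.length_le fun i _ => hD i
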